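/- Theorem 7.8. Let $G$ be a finite group and $K(G)$ the group of its Brauer relations, i.e. the kernel of the natural map $B(G)\to R_{\mathbb Q}(G)$, $X\mapsto\mathbb Q[X]$, from the Burnside ring to the rational representation ring; elements of $B(G)$ are written $\sum_i n_iH_i$, where a subgroup $H\le G$ (taken up to conjugacy) stands for the $G$-set $G/H$. A relation is imprimitive if it is a $\mathbb Z$-linear combination of relations induced from proper subgroups of $G$ and of relations lifted (inflated) from proper quotients of $G$, and primitive otherwise; $\mathrm{Prim}(G)$ is the quotient of $K(G)$ by the subgroup of imprimitive relations. Let $p$ be a prime and let $G=C\rtimes P$, where $P$ is a $p$-group and $C$ is cyclic of order $l_1\cdots l_t$ for distinct primes $l_j\neq p$, with $t>1$. Assume that $P$ acts faithfully on $C$. Let $C_{l_i}$ be the subgroup of $C$ of order $l_i$, and for $1\le j\le t$ put $K_j=\bigcap_{i\ne j}\ker(P\to\mathrm{Aut}\,C_{l_i})$. Define the signature of a subgroup $M\le P$ of index $p$ to be the vector in $\mathbb F_2^t$ whose $j$-th coordinate is $1$ if $K_j\subseteq M$ and $0$ otherwise. Then the following are equivalent: (a) $G$ has a primitive relation; (b)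 all $K_j$ have the same, non-trivial image in the Frattini quotient $P/\Phi(P)$; (c) the set of signatures of the index $p$ subgroups of $P$ is $\{(1,\ldots,1),(0,\ldots,0)\}$. If these conditions hold, then $\mathrm{Prim}(G)\cong C_p$. Moreover, in that case, for any index $p$ subgroups $M,M'\le P$ with signatures $(1,\ldots,1)$ and $(0,\ldots,0)$, respectively, the element $$\sum_{U\le C}\mu(|U|)\,(MU-M'U)$$ of $B(G)$, where $\mu$ is the Möbius function, is a relation and its class generates $\mathrm{Prim}(G)$. -/

import Mathlib

noncomputable section

namespace BrauerRel

universe u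

/-- Two subgroups of `G` are conjugate. -/
def conjSetoid (G : Type u) [Group G] : Setoid (Subgroup G) where
  r H H' := ∃ g : G, H.map (MulAut.conj g).toMonoidHom = H'
  iseqv :=
    { refl := fun H => ⟨1, by
        ext x
        simp [Subgroup.mem_map]⟩
      symm := by
        rintro H _ ⟨g, rfl⟩
        refine ⟨g⁻¹, ?_⟩
        ext x
        simp [Subgroup.mem_map, mul_assoc]
      trans := by
        rintro H _ _ ⟨g, rfl⟩ ⟨g', rfl⟩
        refine ⟨g' * g, ?_⟩
        ext x
        simp [Subgroup.mem_map, mul_assoc] }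

/-- Conjugacy classes of subgroups of `G`. -/
abbrev SubgroupClass (G : Type u) [Group G] : Type u := Quotient (conjSetoid G)

/-- The additive group of the Burnside ring `B(G)`: the free abelian group on the conjugacy
classes of subgroups, the class of `H` standing for the transitive `G`-set `G ⧸ H`. -/
abbrev Burnside (G : Type u) [Group G] : Type u := SubgroupClass G →₀ ℤ

/-- The element of `B(G)` given by a subgroup `H`, that is, by the `G`-set `G ⧸ H`. -/
def cls {G : Type u} [Group G] (H : Subgroup G) : Burnside G :=
  Finsupp.single (Quotient.mk (conjSetoid G) H) 1

/-- The rational representation ring `R_ℚ(G)` (its additive group), realised as usual as the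
group of functions on `G` generated by the characters of the finite-dimensional
representations of `G` over `ℚ`. -/
def ratRepGroup (G : Type u) [Group G] : AddSubgroup (G → ℚ) :=
  AddSubgroup.closure
    {χ | ∃ (V : Type u) (_ : AddCommGroup V) (_ : Module ℚ V) (_ : FiniteDimensional ℚ V)
      (ρ : Representation ℚ G V), χ = ρ.character}

/-- The permutation representation `ℚ[G/H]`. -/
abbrev permRep {G : Type u} [Group G] (H : Subgroup G) :
    Representation ℚ G (MonoidAlgebra ℚ (G ⧸ H)) :=
  Representation.ofMulAction ℚ G (G ⧸ H)

theorem permRep_character_mem {G : Type u} [Group G] [Finite G] (H : Subgroup G) :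
    (permRep H).character ∈ ratRepGroup G :=
  AddSubgroup.subset_closure
    ⟨MonoidAlgebra ℚ (G ⧸ H), inferInstance, inferInstance,
      Module.Finite.equiv (MonoidAlgebra.coeffLinearEquiv ℚ).symm, permRep H, rfl⟩

theorem permRep_character_conj {G : Type u} [Group G] (H : Subgroup G) (g : G) :
    (permRep H).character = (permRep (H.map (MulAut.conj g).toMonoidHom)).character := by
  -- the isomorphism of `G`-sets `x H ↦ x g⁻¹ (g H g⁻¹)`
  let e : G ⧸ H ≃ G ⧸ (H.map (MulAut.conj g).toMonoidHom) :=
    Quotient.congr (Equiv.mulRight g⁻¹) (by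
      intro a b
      change QuotientGroup.leftRel H a b ↔ QuotientGroup.leftRel _ (a * g⁻¹) (b * g⁻¹)
      rw [QuotientGroup.leftRel_apply, QuotientGroup.leftRel_apply]
      constructor
      · intro h
        exact ⟨a⁻¹ * b, h, by simp [mul_assoc]⟩
      · rintro ⟨x, hx, hxe⟩
        have hx' : a⁻¹ * b = x := by
          have h1 : g * x * g⁻¹ = (a * g⁻¹)⁻¹ * (b * g⁻¹) := hxe
          have h2 : g * x * g⁻¹ = g * (a⁻¹ * b) * g⁻¹ := by rw [h1]; group
          exact (mul_left_cancel (mul_right_cancel h2)).symm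
        rw [hx']
        exact hx)
  have he : ∀ (x : G) (q : G ⧸ H), e (x • q) = x • e q := by
    intro x q
    induction q using Quotient.inductionOn with
    | h a =>
      change (QuotientGroup.mk (x * a * g⁻¹) : G ⧸ (H.map (MulAut.conj g).toMonoidHom)) =
        QuotientGroup.mk (x * (a * g⁻¹))
      rw [mul_assoc]
  let E : MonoidAlgebra ℚ (G ⧸ H) ≃ₗ[ℚ]
      MonoidAlgebra ℚ (G ⧸ (H.map (MulAut.conj g).toMonoidHom)) :=
    (MonoidAlgebra.coeffLinearEquiv ℚ).trans
      ((Finsupp.domLCongr e).trans (MonoidAlgebra.coeffLinearEquiv ℚ).symm)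
  have hE : ∀ q : G ⧸ H, E (MonoidAlgebra.single q 1) = MonoidAlgebra.single (e q) 1 := by
    intro q
    exact congrArg (MonoidAlgebra.coeffLinearEquiv ℚ).symm (Finsupp.domLCongr_single e q (1 : ℚ))
  refine Representation.char_iso (Representation.Equiv.mk E ?_)
  intro x
  refine MonoidAlgebra.lhom_ext' fun q => LinearMap.ext_ring ?_
  change E (permRep H x (MonoidAlgebra.single q 1)) =
    permRep _ x (E (MonoidAlgebra.single q 1))
  rw [hE, Representation.ofMulAction_single, Representation.ofMulAction_single, hE, he]

/-- The class of `ℚ[G/H]` in `R_ℚ(G)`; it depends only on the conjugacy class of `H`. -/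
def permClass (G : Type u) [Group G] [Finite G] : SubgroupClass G → ratRepGroup G :=
  Quotient.lift (s := conjSetoid G)
    (fun H => (⟨(permRep H).character, permRep_character_mem H⟩ : ratRepGroup G)) (by
      rintro H _ ⟨g, rfl⟩
      exact Subtype.ext (permRep_character_conj H g))

/-- The natural map `B(G) → R_ℚ(G)`, `X ↦ ℚ[X]`. -/
def linearization (G : Type u) [Group G] [Finite G] : Burnside G →+ ratRepGroup G :=
  Finsupp.liftAddHom fun c => zmultiplesHom (ratRepGroup G) (permClass G c)

/-- The group `K(G)` of Brauer relations of `G`. -/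
def relations (G : Type u) [Group G] [Finite G] : AddSubgroup (Burnside G) :=
  (linearization G).ker

/-- Induction `B(D) → B(G)` from a subgroup `D` of `G`, sending `H ≤ D` to `H ≤ G`. -/
def ind {G : Type u} [Group G] (D : Subgroup G) : Burnside D →+ Burnside G :=
  Finsupp.mapDomain.addMonoidHom
    (Quotient.map' (s₁ := conjSetoid D) (s₂ := conjSetoid G)
      (fun H : Subgroup D => H.map D.subtype) (by
        rintro H _ ⟨g, rfl⟩
        refine ⟨(g : G), ?_⟩
        rw [Subgroup.map_map, Subgroup.map_map]
        rfl))

/-- Inflation `B(G/N) → B(G)` from a quotient of `G`, sending `H ≤ G/N` to its preimage. -/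
def inflate {G : Type u} [Group G] (N : Subgroup G) [N.Normal] : Burnside (G ⧸ N) →+ Burnside G :=
  Finsupp.mapDomain.addMonoidHom
    (Quotient.map' (s₁ := conjSetoid (G ⧸ N)) (s₂ := conjSetoid G)
      (fun H : Subgroup (G ⧸ N) => H.comap (QuotientGroup.mk' N)) (by
        rintro H _ ⟨q, rfl⟩
        obtain ⟨g, rfl⟩ := QuotientGroup.mk'_surjective N q
        refine ⟨g, ?_⟩
        ext x
        constructor
        · rintro ⟨y, hy, rfl⟩
          exact ⟨QuotientGroup.mk' N y, hy, by simp⟩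
        · rintro ⟨z, hz, hzx⟩
          refine ⟨g⁻¹ * x * g, ?_, by simp [mul_assoc]⟩
          have hz' : z = QuotientGroup.mk' N (g⁻¹ * x * g) := by
            rw [map_mul, map_mul, ← hzx]
            simp [mul_assoc]
          change QuotientGroup.mk' N (g⁻¹ * x * g) ∈ H
          rw [← hz']
          exact hz))

/-- The group of imprimitive relations: the span of all relations induced from proper
subgroups of `G` and all relations lifted from proper quotients of `G`. -/
def imprimitive (G : Type u) [Group G] [Finite G] : AddSubgroup (Burnside G) :=
  (⨆ (D : Subgroup G) (_ : D ≠ ⊤), (relations D).map (ind D)) ⊔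
    ⨆ (N : Subgroup G) (_ : N.Normal) (_ : N ≠ ⊥), (relations (G ⧸ N)).map (inflate N)

/-- `G` has a primitive relation. -/
def HasPrimitiveRelation (G : Type u) [Group G] [Finite G] : Prop :=
  ∃ Θ ∈ relations G, Θ ∉ imprimitive G

/-- `Prim(G)`, the quotient of `K(G)` by the imprimitive relations. -/
abbrev Prim (G : Type u) [Group G] [Finite G] : Type u :=
  relations G ⧸ (imprimitive G).addSubgroupOf (relations G)

variable {G : Type u} [Group G]

/-- The subgroup `C_l` of a cyclic group `C`: the elements of `C` killed by `l`. -/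
def torsionPart (C : Subgroup G) (l : ℕ) : Subgroup G :=
  Subgroup.closure {c | c ∈ C ∧ c ^ l = 1}

/-- The kernel of the conjugation action of `P` on `D`. -/
def actionKer (P D : Subgroup G) : Subgroup P :=
  (Subgroup.centralizer (D : Set G)).subgroupOf P

/-- `K_j = ⋂_{i ≠ j} ker (P → Aut C_{l_i})`. -/
def Kj (C P : Subgroup G) {t : ℕ} (l : Fin t → ℕ) (j : Fin t) : Subgroup P :=
  ⨅ (i : Fin t) (_ : i ≠ j), actionKer P (torsionPart C (l i))

/-- The image of a subgroup of `P` in the Frattini quotient `P/Φ(P)`. -/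
def frattiniImage {P : Type u} [Group P] (H : Subgroup P) : Subgroup (P ⧸ frattini P) :=
  H.map (QuotientGroup.mk' (frattini P))

/-- The signature of a subgroup `M` of `P`: its `j`-th coordinate is `1` if `K_j ≤ M` and `0`
otherwise. -/
def signature (C P : Subgroup G) {t : ℕ} (l : Fin t → ℕ) (M : Subgroup P) : Fin t → ZMod 2 :=
  open Classical in fun j => if Kj C P l j ≤ M then 1 else 0

/-- `∑_{U ≤ C} μ(|U|) (M U - M' U)` for subgroups `M`, `M'` of `P`. -/
def thetaRel (C P : Subgroup G) (M M' : Subgroup P) : Burnside G :=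
  ∑ᶠ U : Subgroup C, ArithmeticFunction.moebius (Nat.card U) •
    (cls (M.map P.subtype ⊔ U.map C.subtype) - cls (M'.map P.subtype ⊔ U.map C.subtype))

end BrauerRel

end

noncomputable section

set_option linter.unusedSectionVars false

/-! For A ⊆ {1,…,t} let C_A ≤ C be the subgroup of order ∏_{i∈A} l_i, and put a(H) = ∑_A (-1)^|A|
H·C_A. The operator a is the product of the commuting factors 1 - (H ↦ H·C_{l_i}). On a relation
each factor subtracts a relation inflated from G/C_{l_i}, so a(Θ) ≡ Θ modulo imprimitive relations.
Moreover a(H) = 0 as soon as H meets C. By Sylow, K(G) is therefore spanned modulo imprimitive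
relations by combinations of the a(Q), Q ≤ P, and evaluating Θ at generators of the C_A shows that
their coefficients satisfy ∑ n_Q [P:Q] = 0 (`exists_eq_sum_altClassOf`).

The linear dependencies among the a(Q) come from `altHom_mem_relOn`: a combination m of subgroups of
R ≤ P yields a relation of R ⋉ C_S when ∑_{Q∋x} m_Q/|Q| vanishes for every x ∈ R centralising C_S.
Taking R = M of index p and S everything gives a(Q) ≡ [M:Q] a(M) for Q ≤ M. Taking R = P and
omitting i from S, where the centralising elements form K_i, gives a(M) ≡ p·a(P) if K_i ≤ M, and
a(M) ≡ a(M') if neither M nor M' contains K_i: K_i is cyclic, so both meet it in the same subgroup.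

If the signatures are not exactly the two constant vectors, these congruences give a(M) ≡ p·a(P) for
every M of index p, hence a(Q) ≡ [P:Q] a(P) for all Q, and all relations are imprimitive. Otherwise
they leave one extra generator θ = a(M) - a(M'), and pθ ≡ 0 because p·a(M) and p·a(M') both equal
a(M ∩ M').

That θ is primitive is shown by a functional B(G) → 𝔽_p, the sum of the coefficients of those H of
order |P|/p for which HC ∩ P does not contain K_i. It takes the value -1 on θ and kills every
imprimitive relation; relations induced from D are split according to whether DC = G
(`sum_detect_of_sup_ne_top`, `sum_detect_of_sup_eq_top`, `sum_detect_of_relAbove`).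

The Frattini condition matches the signatures because P is abelian and every subgroup above Φ(P) is
an intersection of subgroups of index p. -/

namespace BrauerRel

universe u

/-! ### Permutation characters as counts of conjugates -/

section Characters

variable {G : Type u} [Group G]

/-- The number of fixed points of `g` on the `D`-set `D ⧸ H`, for subgroups `H ≤ D`. -/
def fixCount (D H : Subgroup G) (g : G) : ℚ :=
  (Nat.card {x : D // (x : G)⁻¹ * g * x ∈ H} : ℚ) / Nat.card H

theorem character_ofMulAction {X : Type*} [Finite X] [MulAction G X] (g : G) :
    (Representation.ofMulAction ℚ G X).character g = Nat.card {x : X // g • x = x} := by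
  classical
  have := Fintype.ofFinite X
  let b : Module.Basis X ℚ (MonoidAlgebra ℚ X) := ⟨MonoidAlgebra.coeffLinearEquiv ℚ⟩
  have hb : ∀ x, b x = MonoidAlgebra.single x 1 := fun x => rfl
  rw [Representation.character, LinearMap.trace_eq_matrix_trace ℚ b, Matrix.trace]
  have : ∀ x, (LinearMap.toMatrix b b (Representation.ofMulAction ℚ G X g)).diag x
      = if g • x = x then 1 else 0 := by
    intro x
    rw [Matrix.diag_apply, LinearMap.toMatrix_apply, hb, Representation.ofMulAction_single,
      ← hb, b.repr_self, Finsupp.single_apply]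
  rw [Finset.sum_congr rfl (fun x _ => this x), Finset.sum_boole, Nat.card_eq_fintype_card,
    Fintype.card_subtype]

/-- The coset xH is fixed by g exactly when x⁻¹gx ∈ H, and each coset has |H| representatives. -/
theorem card_fixed_quotient (H : Subgroup G) (g : G) :
    Nat.card {x : G // x⁻¹ * g * x ∈ H} =
      Nat.card {q : G ⧸ H // g • q = q} * Nat.card H := by
  classical
  rw [← Nat.card_prod]
  refine Nat.card_congr ?_
  have key : ∀ x : G, x⁻¹ * g * x ∈ H ↔ g • (x : G ⧸ H) = (x : G ⧸ H) := by
    intro x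
    rw [MulAction.Quotient.smul_coe, smul_eq_mul, eq_comm, QuotientGroup.eq, mul_assoc]
  let e := Subgroup.groupEquivQuotientProdSubgroup (s := H)
  have he : ∀ x : G, (e x).1 = (x : G ⧸ H) := fun x => by
    simp only [e, Subgroup.groupEquivQuotientProdSubgroup]
    rfl
  refine (Equiv.subtypeEquiv e (q := fun y => g • y.1 = y.1) fun x => ?_).trans ?_
  · rw [key, he]
  · exact
      { toFun := fun y => (⟨y.1.1, y.2⟩, y.1.2)
        invFun := fun y => ⟨(y.1.1, y.2), y.1.2⟩
        left_inv := fun _ => rfl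
        right_inv := fun _ => rfl }

theorem permRep_character [Finite G] (H : Subgroup G) (g : G) :
    (permRep H).character g = (Nat.card {x : G // x⁻¹ * g * x ∈ H} : ℚ) / Nat.card H := by
  rw [character_ofMulAction, card_fixed_quotient, Nat.cast_mul, mul_div_cancel_right₀]
  exact_mod_cast Nat.card_pos.ne'

theorem permRep_character_eq_fixCount_top [Finite G] (H : Subgroup G) (g : G) :
    (permRep H).character g = fixCount ⊤ H g := by
  rw [permRep_character, fixCount]
  congr 2
  exact Nat.card_congr (Equiv.subtypeEquiv Subgroup.topEquiv.symm.toEquiv fun x => Iff.rfl)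

theorem permRep_character_subgroup [Finite G] (D : Subgroup G) (H : Subgroup D) (d : D) :
    (permRep H).character d = fixCount D (H.map D.subtype) d := by
  rw [permRep_character, fixCount]
  congr 2
  · refine Nat.card_congr (Equiv.subtypeEquiv (Equiv.refl _) fun x => ?_)
    simp only [Equiv.refl_apply]
    constructor
    · intro h; exact ⟨_, h, rfl⟩
    · rintro ⟨y, hy, he⟩
      have : y = x⁻¹ * d * x := Subtype.ext he
      exact this ▸ hy
  · exact Nat.card_congr (H.equivMapOfInjective _ D.subtype_injective).toEquiv

theorem card_subtype_comp_mk (N : Subgroup G) [N.Normal] (p : G ⧸ N → Prop) :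
    Nat.card {x : G // p x} = Nat.card {x : G ⧸ N // p x} * Nat.card N := by
  rw [← Nat.card_prod]
  let e := Subgroup.groupEquivQuotientProdSubgroup (s := N)
  have he : ∀ x : G, (e x).1 = (x : G ⧸ N) := fun x => by
    simp only [e, Subgroup.groupEquivQuotientProdSubgroup]
    rfl
  refine Nat.card_congr
    ((Equiv.subtypeEquiv e (q := fun y => p y.1) fun x => by rw [he]).trans ?_)
  exact
    { toFun := fun y => (⟨y.1.1, y.2⟩, y.1.2)
      invFun := fun y => ⟨(y.1.1, y.2), y.1.2⟩
      left_inv := fun _ => rfl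
      right_inv := fun _ => rfl }

/-- Pulling back along G → G/N multiplies both the number of conjugating elements and the order of
the subgroup by |N|. -/
theorem permRep_character_quotient [Finite G] (N : Subgroup G) [N.Normal]
    (H : Subgroup (G ⧸ N)) (g : G) :
    (permRep H).character (g : G ⧸ N) = fixCount ⊤ (H.comap (QuotientGroup.mk' N)) g := by
  rw [← permRep_character_eq_fixCount_top, permRep_character, permRep_character]
  have h1 := card_subtype_comp_mk N (fun x => x⁻¹ * (g : G ⧸ N) * x ∈ H)
  have h2 := card_subtype_comp_mk N (fun x => x ∈ H)
  have h3 : Nat.card {x : G // x⁻¹ * g * x ∈ H.comap (QuotientGroup.mk' N)} =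
    Nat.card {x : G // ((x : G ⧸ N))⁻¹ * (g : G ⧸ N) * x ∈ H} := rfl
  have h4 : Nat.card (H.comap (QuotientGroup.mk' N)) = Nat.card {x : G // (x : G ⧸ N) ∈ H} := rfl
  have h5 : Nat.card {x : G ⧸ N // x ∈ H} = Nat.card H := rfl
  rw [h3, h4, h1, h2, h5, Nat.cast_mul, Nat.cast_mul, mul_div_mul_right]
  exact_mod_cast Nat.card_pos.ne'

end Characters

/-! ### Formal combinations of subgroups in place of the Burnside ring -/

section Combinations

variable {G : Type u} [Group G]

/-- The element of the Burnside ring given by a formal combination of subgroups. -/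
def toBurnside : (Subgroup G →₀ ℤ) →+ Burnside G :=
  Finsupp.mapDomain.addMonoidHom (Quotient.mk (conjSetoid G))

@[simp]
theorem toBurnside_single (H : Subgroup G) (k : ℤ) :
    toBurnside (Finsupp.single H k) = k • cls H := by
  simp [toBurnside, cls, Finsupp.mapDomain_single]

theorem toBurnside_surjective : Function.Surjective (toBurnside (G := G)) := by
  intro Θ
  refine ⟨Θ.mapDomain Quotient.out, ?_⟩
  change Finsupp.mapDomain _ (Finsupp.mapDomain _ _) = _
  rw [← Finsupp.mapDomain_comp]
  have : Quotient.mk (conjSetoid G) ∘ Quotient.out = id := by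
    funext x; exact Quotient.out_eq x
  rw [this, Finsupp.mapDomain_id]

theorem ind_toBurnside (D : Subgroup G) (n : Subgroup D →₀ ℤ) :
    ind D (toBurnside n) = toBurnside (n.mapDomain (Subgroup.map D.subtype)) := by
  change Finsupp.mapDomain _ (Finsupp.mapDomain _ _) = Finsupp.mapDomain _ (Finsupp.mapDomain _ _)
  rw [← Finsupp.mapDomain_comp, ← Finsupp.mapDomain_comp]
  rfl

theorem inflate_toBurnside (N : Subgroup G) [N.Normal] (n : Subgroup (G ⧸ N) →₀ ℤ) :
    inflate N (toBurnside n) =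
      toBurnside (n.mapDomain (Subgroup.comap (QuotientGroup.mk' N))) := by
  change Finsupp.mapDomain _ (Finsupp.mapDomain _ _) = Finsupp.mapDomain _ (Finsupp.mapDomain _ _)
  rw [← Finsupp.mapDomain_comp, ← Finsupp.mapDomain_comp]
  rfl

/-- The value at `g` of the permutation character of `D` of a combination of subgroups of `D`. -/
def fixHom (D : Subgroup G) (g : G) : (Subgroup G →₀ ℤ) →+ ℚ :=
  Finsupp.liftAddHom fun H => zmultiplesHom ℚ (fixCount D H g)

@[simp]
theorem fixHom_single (D : Subgroup G) (g : G) (H : Subgroup G) (k : ℤ) :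
    fixHom D g (Finsupp.single H k) = k * fixCount D H g := by
  simp [fixHom]

theorem fixHom_apply (D : Subgroup G) (g : G) (n : Subgroup G →₀ ℤ) :
    fixHom D g n = n.sum fun H k => k * fixCount D H g := by
  rw [fixHom, Finsupp.liftAddHom_apply]
  exact Finsupp.sum_congr fun H _ => by simp

/-- Combinations of subgroups of `D` whose permutation character on `D` vanishes. -/
def relOn (D : Subgroup G) : AddSubgroup (Subgroup G →₀ ℤ) where
  carrier := {n | (∀ H ∈ n.support, H ≤ D) ∧ ∀ d ∈ D, fixHom D d n = 0}
  zero_mem' := by simp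
  add_mem' := by
    classical
    rintro a b ⟨ha, ha'⟩ ⟨hb, hb'⟩
    refine ⟨fun H hH => ?_, fun d hd => by rw [map_add, ha' d hd, hb' d hd, add_zero]⟩
    rcases Finset.mem_union.1 (Finsupp.support_add hH) with h | h
    · exact ha H h
    · exact hb H h
  neg_mem' := by
    rintro a ⟨ha, ha'⟩
    exact ⟨fun H hH => ha H (by simpa using hH), fun d hd => by rw [map_neg, ha' d hd, neg_zero]⟩

/-- Combinations of subgroups containing `N` whose permutation character vanishes. -/
def relAbove (N : Subgroup G) : AddSubgroup (Subgroup G →₀ ℤ) where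
  carrier := {n | (∀ H ∈ n.support, N ≤ H) ∧ ∀ g, fixHom ⊤ g n = 0}
  zero_mem' := by simp
  add_mem' := by
    classical
    rintro a b ⟨ha, ha'⟩ ⟨hb, hb'⟩
    refine ⟨fun H hH => ?_, fun d => by rw [map_add, ha' d, hb' d, add_zero]⟩
    rcases Finset.mem_union.1 (Finsupp.support_add hH) with h | h
    · exact ha H h
    · exact hb H h
  neg_mem' := by
    rintro a ⟨ha, ha'⟩
    exact ⟨fun H hH => ha H (by simpa using hH), fun d => by rw [map_neg, ha' d, neg_zero]⟩

theorem mem_relOn_top (n : Subgroup G →₀ ℤ) : n ∈ relOn (⊤ : Subgroup G) ↔ ∀ g, fixHom ⊤ g n = 0 :=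
  ⟨fun h g => h.2 g trivial, fun h => ⟨fun _ _ => le_top, fun g _ => h g⟩⟩

variable [Finite G]

theorem linearization_toBurnside (n : Subgroup G →₀ ℤ) (g : G) :
    (linearization G (toBurnside n) : G → ℚ) g = n.sum fun H k => k * (permRep H).character g := by
  induction n using Finsupp.induction_linear with
  | zero => simp
  | add f g hf hg =>
    rw [map_add, map_add, Finsupp.sum_add_index' (by simp) (by intros; push_cast; ring)]
    simp only [AddSubgroup.coe_add, Pi.add_apply, hf, hg]
  | single H k =>
    rw [toBurnside_single, map_zsmul, Finsupp.sum_single_index (by simp)]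
    have : (linearization G (cls H) : G → ℚ) = (permRep H).character := by
      simp [linearization, cls, permClass]
    rw [AddSubgroup.coe_zsmul, Pi.smul_apply, this, zsmul_eq_mul]

theorem toBurnside_mem_relations_iff (n : Subgroup G →₀ ℤ) :
    toBurnside n ∈ relations G ↔ ∀ g, n.sum (fun H k => k * (permRep H).character g) = 0 := by
  rw [relations, AddMonoidHom.mem_ker, ← Subtype.coe_inj, funext_iff]
  simp only [linearization_toBurnside]
  rfl

theorem toBurnside_mem_relations (n : Subgroup G →₀ ℤ) :
    toBurnside n ∈ relations G ↔ ∀ g, fixHom ⊤ g n = 0 := by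
  rw [toBurnside_mem_relations_iff]
  simp only [fixHom_apply, permRep_character_eq_fixCount_top]

/-- With `map_inflate_relations`, this lets all later arguments take place among subgroups of the
single group G, never among subgroups of D or of a quotient. -/
theorem map_ind_relations (D : Subgroup G) :
    (relations D).map (ind D) = (relOn D).map toBurnside := by
  have hsum : ∀ (n : Subgroup D →₀ ℤ) (d : D),
      fixHom D (d : G) (n.mapDomain (Subgroup.map D.subtype)) =
        n.sum fun H k => k * (permRep H).character d := by
    intro n d
    rw [fixHom_apply, Finsupp.sum_mapDomain_index (by simp) (by intros; push_cast; ring)]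
    simp only [permRep_character_subgroup]
  ext Θ
  simp only [AddSubgroup.mem_map]
  constructor
  · rintro ⟨Ψ, hΨ, rfl⟩
    obtain ⟨n, rfl⟩ := toBurnside_surjective Ψ
    refine ⟨_, ⟨?_, ?_⟩, (ind_toBurnside D n).symm⟩
    · classical
      intro H hH
      obtain ⟨H', -, rfl⟩ := Finset.mem_image.1 (Finsupp.mapDomain_support hH)
      exact Subgroup.map_subtype_le H'
    · intro d hd
      exact (hsum n ⟨d, hd⟩).trans ((toBurnside_mem_relations_iff n).1 hΨ ⟨d, hd⟩)
  · rintro ⟨n, ⟨hn, hn'⟩, rfl⟩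
    have h : (n.mapDomain (fun H => H.subgroupOf D)).mapDomain (Subgroup.map D.subtype) = n := by
      rw [← Finsupp.mapDomain_comp]
      conv_rhs => rw [← Finsupp.mapDomain_id (v := n)]
      refine Finsupp.mapDomain_congr fun H hH => ?_
      simpa using hn H hH
    refine ⟨toBurnside (n.mapDomain fun H => H.subgroupOf D), ?_, ?_⟩
    · rw [toBurnside_mem_relations_iff]
      intro d
      rw [← hsum, h]
      exact hn' d d.2
    · rw [ind_toBurnside, h]

theorem map_inflate_relations (N : Subgroup G) [N.Normal] :
    (relations (G ⧸ N)).map (inflate N) = (relAbove N).map toBurnside := by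
  have hsum : ∀ (n : Subgroup (G ⧸ N) →₀ ℤ) (g : G),
      fixHom ⊤ g (n.mapDomain (Subgroup.comap (QuotientGroup.mk' N))) =
        n.sum fun H k => k * (permRep H).character (g : G ⧸ N) := by
    intro n d
    rw [fixHom_apply, Finsupp.sum_mapDomain_index (by simp) (by intros; push_cast; ring)]
    simp only [permRep_character_quotient]
  ext Θ
  simp only [AddSubgroup.mem_map]
  constructor
  · rintro ⟨Ψ, hΨ, rfl⟩
    obtain ⟨n, rfl⟩ := toBurnside_surjective Ψ
    refine ⟨_, ⟨?_, ?_⟩, (inflate_toBurnside N n).symm⟩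
    · classical
      intro H hH
      obtain ⟨H', -, rfl⟩ := Finset.mem_image.1 (Finsupp.mapDomain_support hH)
      exact QuotientGroup.le_comap_mk' N H'
    · intro g
      exact (hsum n g).trans ((toBurnside_mem_relations_iff n).1 hΨ g)
  · rintro ⟨n, ⟨hn, hn'⟩, rfl⟩
    have h : (n.mapDomain (Subgroup.map (QuotientGroup.mk' N))).mapDomain
        (Subgroup.comap (QuotientGroup.mk' N)) = n := by
      rw [← Finsupp.mapDomain_comp]
      conv_rhs => rw [← Finsupp.mapDomain_id (v := n)]
      refine Finsupp.mapDomain_congr fun H hH => ?_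
      simpa using hn H hH
    refine ⟨toBurnside (n.mapDomain (Subgroup.map (QuotientGroup.mk' N))), ?_, ?_⟩
    · rw [toBurnside_mem_relations_iff]
      intro q
      obtain ⟨g, rfl⟩ := QuotientGroup.mk_surjective q
      rw [← hsum, h]
      exact hn' g
    · rw [inflate_toBurnside, h]

theorem toBurnside_mem_imprimitive_of_relOn {D : Subgroup G} (hD : D ≠ ⊤)
    {n : Subgroup G →₀ ℤ} (hn : n ∈ relOn D) : toBurnside n ∈ imprimitive G := by
  have h : toBurnside n ∈ (relations D).map (ind D) := by
    rw [map_ind_relations]; exact ⟨n, hn, rfl⟩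
  exact AddSubgroup.mem_sup_left (AddSubgroup.mem_iSup_of_mem D (AddSubgroup.mem_iSup_of_mem hD h))

theorem toBurnside_mem_imprimitive_of_relAbove {N : Subgroup G} (hN : N.Normal) (hN' : N ≠ ⊥)
    {n : Subgroup G →₀ ℤ} (hn : n ∈ relAbove N) : toBurnside n ∈ imprimitive G := by
  have h : toBurnside n ∈ (relations (G ⧸ N)).map (inflate N) := by
    rw [map_inflate_relations]; exact ⟨n, hn, rfl⟩
  exact AddSubgroup.mem_sup_right (AddSubgroup.mem_iSup_of_mem N
    (AddSubgroup.mem_iSup_of_mem hN (AddSubgroup.mem_iSup_of_mem hN' h)))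

/-- To bound the imprimitive relations from above it suffices to treat combinations of
subgroups of a proper subgroup, and of subgroups above a non-trivial normal subgroup. -/
theorem imprimitive_le {A : AddSubgroup (Burnside G)}
    (h₁ : ∀ D : Subgroup G, D ≠ ⊤ → ∀ n ∈ relOn D, toBurnside n ∈ A)
    (h₂ : ∀ N : Subgroup G, N.Normal → N ≠ ⊥ → ∀ n ∈ relAbove N, toBurnside n ∈ A) :
    imprimitive G ≤ A := by
  refine sup_le (iSup_le fun D => iSup_le fun hD => ?_)
    (iSup_le fun N => iSup_le fun hN => iSup_le fun hN' => ?_)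
  · rw [map_ind_relations]
    rintro _ ⟨n, hn, rfl⟩
    exact h₁ D hD n hn
  · rw [map_inflate_relations]
    rintro _ ⟨n, hn, rfl⟩
    exact h₂ N hN hN' n hn

end Combinations

/-! ### Characters under H ↦ HN and under induction -/

section Counting

variable {G : Type u} [Group G]

theorem card_sup_mul_card_inf (H N : Subgroup G) [N.Normal] :
    Nat.card (H ⊔ N : Subgroup G) * Nat.card (H ⊓ N : Subgroup G) = Nat.card H * Nat.card N := by
  have h1 := Subgroup.relIndex_mul_relIndex ⊥ N (H ⊔ N) bot_le le_sup_right
  have h2 := Subgroup.relIndex_mul_relIndex ⊥ (H ⊓ N) H bot_le inf_le_left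
  simp only [Subgroup.relIndex_bot_left] at h1 h2
  rw [Subgroup.relIndex_sup_right] at h1
  rw [inf_comm H N, Subgroup.inf_relIndex_right, inf_comm N H] at h2
  rw [← h1, ← h2]
  ring

theorem card_sup_of_disjoint {H N : Subgroup G} [N.Normal] (h : H ⊓ N = ⊥) :
    Nat.card (H ⊔ N : Subgroup G) = Nat.card H * Nat.card N := by
  have := card_sup_mul_card_inf H N
  rwa [h, Subgroup.card_bot, mul_one] at this

theorem card_subtype_eq_sum {α : Type*} [Fintype α] (p : α → Prop) [DecidablePred p] :
    (Nat.card {x : α // p x} : ℚ) = ∑ x, if p x then 1 else 0 := by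
  rw [Finset.sum_boole, Nat.card_eq_fintype_card, Fintype.card_subtype]

theorem fixCount_eq_sum (D H : Subgroup G) [Fintype D] [DecidablePred (· ∈ H)] (g : G) :
    fixCount D H g = (∑ x : D, if (x : G)⁻¹ * g * x ∈ H then 1 else 0) / Nat.card H := by
  rw [fixCount, card_subtype_eq_sum]

theorem fixCount_of_conj_mem_iff {D H : Subgroup G} {g : G}
    (h : ∀ x ∈ D, x⁻¹ * g * x ∈ H ↔ g ∈ H) [Decidable (g ∈ H)] :
    fixCount D H g = if g ∈ H then (Nat.card D : ℚ) / Nat.card H else 0 := by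
  rw [fixCount]
  split_ifs with hg
  · rw [Nat.card_congr (Equiv.subtypeUnivEquiv fun x : D => (h x x.2).2 hg)]
  · have : IsEmpty {x : D // (x : G)⁻¹ * g * x ∈ H} := ⟨fun x => hg ((h _ x.1.2).1 x.2)⟩
    simp

variable [Finite G]

theorem card_pos_rat (H : Subgroup G) : (0 : ℚ) < Nat.card H := by
  exact_mod_cast Nat.card_pos

/-- The character of `ℚ[G/HN]` is the average of the character of `ℚ[G/H]` over cosets of `N`. -/
theorem fixCount_sup (H N : Subgroup G) [N.Normal] [Fintype N] (g : G) :
    fixCount ⊤ (H ⊔ N) g = (∑ n : N, fixCount ⊤ H (g * n)) / Nat.card N := by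
  classical
  have := Fintype.ofFinite G
  -- If x⁻¹gx = hm with h ∈ H and m ∈ N, then n ↦ m·x⁻¹nx identifies the admissible n with H ∩ N; if
  -- x⁻¹gx ∉ HN there are none.
  have key : ∀ x : (⊤ : Subgroup G),
      (Nat.card {n : N // (x : G)⁻¹ * (g * n) * x ∈ H} : ℚ) =
        (if (x : G)⁻¹ * g * x ∈ H ⊔ N then 1 else 0) * Nat.card (H ⊓ N : Subgroup G) := by
    rintro ⟨x, -⟩
    dsimp only
    split_ifs with hx
    · rw [one_mul]
      obtain ⟨h, hh, m, hm, e⟩ := Subgroup.mem_sup_of_normal_right.1 hx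
      have hN : N.Normal := inferInstance
      have e' : ∀ n : G, x⁻¹ * (g * n) * x = h * (m * (x⁻¹ * n * x)) := by
        intro n
        rw [← mul_assoc h m, e]; group
      congr 1
      refine Nat.card_congr
        { toFun := fun n => ⟨m * (x⁻¹ * n.1 * x), ?_, ?_⟩
          invFun := fun y => ⟨⟨x * (m⁻¹ * y.1) * x⁻¹, ?_⟩, ?_⟩
          left_inv := ?_
          right_inv := ?_ }
      · have := n.2
        rw [e'] at this
        exact (Subgroup.mul_mem_cancel_left H hh).1 this
      · refine N.mul_mem hm ?_
        simpa using hN.conj_mem _ n.1.2 x⁻¹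
      · exact hN.conj_mem _ (N.mul_mem (N.inv_mem hm) y.2.2) x
      · rw [e']
        refine H.mul_mem hh ?_
        have : m * (x⁻¹ * (x * (m⁻¹ * (y : G)) * x⁻¹) * x) = y := by group
        rw [this]
        exact y.2.1
      · rintro ⟨n, hn⟩
        ext
        simp [mul_assoc]
      · rintro ⟨n, hn⟩
        ext
        simp [mul_assoc]
    · have : IsEmpty {n : N // x⁻¹ * (g * n) * x ∈ H} := by
        refine ⟨fun n => hx ?_⟩
        have hN : N.Normal := inferInstance
        have h1 : x⁻¹ * (n.1 : G)⁻¹ * x ∈ N := by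
          simpa using hN.conj_mem _ (N.inv_mem n.1.2) x⁻¹
        have h2 := (H ⊔ N).mul_mem (Subgroup.mem_sup_left n.2) (Subgroup.mem_sup_right h1)
        convert h2 using 1
        group
      simp
  have hsum : ∑ n : N, fixCount ⊤ H (g * n) =
      (∑ x : (⊤ : Subgroup G), if (x : G)⁻¹ * g * x ∈ H ⊔ N then (1 : ℚ) else 0) *
        Nat.card (H ⊓ N : Subgroup G) / Nat.card H := by
    simp only [fixCount]
    rw [← Finset.sum_div, Finset.sum_mul]
    congr 1
    simp only [← key]
    simp only [card_subtype_eq_sum]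
    exact Finset.sum_comm
  rw [hsum, fixCount, card_subtype_eq_sum]
  have h1 := card_pos_rat (H ⊔ N)
  have h2 := card_pos_rat H
  have h3 := card_pos_rat N
  have h4 : (Nat.card (H ⊔ N : Subgroup G) : ℚ) * Nat.card (H ⊓ N : Subgroup G) =
    Nat.card H * Nat.card N := by exact_mod_cast card_sup_mul_card_inf H N
  rw [div_div, div_eq_div_iff h1.ne' (mul_pos h2 h3).ne', ← h4]
  ring

/-- The formula for an induced permutation character. -/
theorem fixCount_top_eq_sum (D H : Subgroup G) [Fintype G] (g : G) :
    fixCount ⊤ H g = (∑ y : G, fixCount D H (y⁻¹ * g * y)) / Nat.card D := by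
  classical
  have hD := card_pos_rat D
  rw [← permRep_character_eq_fixCount_top, permRep_character, card_subtype_eq_sum]
  simp only [fixCount_eq_sum, ← Finset.sum_div]
  rw [div_div, mul_comm, ← div_div]
  congr 1
  rw [eq_div_iff hD.ne', Finset.sum_comm]
  have : ∀ d : D, (∑ y : G, if (d : G)⁻¹ * (y⁻¹ * g * y) * d ∈ H then (1 : ℚ) else 0) =
      ∑ x : G, if x⁻¹ * g * x ∈ H then 1 else 0 := by
    intro d
    refine Fintype.sum_equiv (Equiv.mulRight (d : G)) _ _ fun y => ?_
    simp [mul_assoc]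
  simp only [this, Finset.sum_const, nsmul_eq_mul, Finset.card_univ, Nat.card_eq_fintype_card]
  ring

/-- If `g` acts without fixed points on `N ∖ {1}`, passing from `H` to `HN` does not change the
number of fixed points of `g`. -/
theorem fixCount_sup_of_fixedPointFree {D H N : Subgroup G} [hN : N.Normal] (hND : N ≤ D)
    (hcomm : ∀ a ∈ N, ∀ b ∈ N, a * b = b * a) (hHN : H ⊓ N = ⊥) {g : G}
    (hg : ∀ c ∈ N, c * g = g * c → c = 1) :
    fixCount D (H ⊔ N) g = fixCount D H g := by
  classical
  have := Fintype.ofFinite G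
  -- When x⁻¹gx lies in HN, exactly one of the |N| translates xc conjugates g into H; this
  -- compensates |HN| = |H||N| in the denominator.
  have key : ∀ x : D, (Nat.card {c : N // ((x : G) * c)⁻¹ * g * (x * c) ∈ H} : ℚ) =
      if (x : G)⁻¹ * g * x ∈ H ⊔ N then 1 else 0 := by
    rintro ⟨x, -⟩
    dsimp only
    split_ifs with hx
    · obtain ⟨h, hh, m, hm, e⟩ := Subgroup.mem_sup_of_normal_right.1 hx
      have hcent : ∀ c ∈ N, h⁻¹ * c * h = c → c = 1 := by
        intro c hc hc'
        have h1 : x * c * x⁻¹ = 1 := by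
          refine hg _ (hN.conj_mem c hc x) ?_
          have hch : c * h = h * c := by
            rw [mul_assoc, inv_mul_eq_iff_eq_mul] at hc'; exact hc'
          have hcy : c * (x⁻¹ * g * x) = x⁻¹ * g * x * c := by
            rw [← e, ← mul_assoc, hch, mul_assoc, hcomm c hc m hm, mul_assoc]
          calc x * c * x⁻¹ * g = x * (c * (x⁻¹ * g * x)) * x⁻¹ := by group
            _ = x * (x⁻¹ * g * x * c) * x⁻¹ := by rw [hcy]
            _ = g * (x * c * x⁻¹) := by group
        simpa using h1
      -- The translate xc is admissible iff f(c) = m. As N is abelian, h acts on it as hm = x⁻¹gx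
      -- does, without nontrivial fixed points; so f is injective, hence bijective.
      let f : N → N := fun c => ⟨(h⁻¹ * c * h) * (c : G)⁻¹,
        N.mul_mem (by simpa using hN.conj_mem c c.2 h⁻¹) (N.inv_mem c.2)⟩
      have hf : Function.Injective f := by
        intro c d hcd
        have h1 : (h⁻¹ * c * h) * (c : G)⁻¹ = (h⁻¹ * d * h) * (d : G)⁻¹ := congrArg Subtype.val hcd
        have h2 : ((d⁻¹ * c : N) : G) = 1 := by
          refine hcent _ (d⁻¹ * c).2 ?_
          have h3 : (h⁻¹ * c * h) = (h⁻¹ * d * h) * (d : G)⁻¹ * c := by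
            rw [← h1]; group
          calc h⁻¹ * ((d⁻¹ * c : N) : G) * h = (h⁻¹ * d * h)⁻¹ * (h⁻¹ * c * h) := by
                push_cast; group
            _ = ((d⁻¹ * c : N) : G) := by rw [h3]; push_cast; group
        have h4 : d⁻¹ * c = 1 := Subtype.ext h2
        exact (inv_mul_eq_one.1 h4).symm
      obtain ⟨c₀, hc₀⟩ := (Finite.injective_iff_surjective.1 hf) ⟨m, hm⟩
      have hiff : ∀ c : N, (x * (c : G))⁻¹ * g * (x * c) ∈ H ↔ c = c₀ := by
        intro c
        have h1 : (x * (c : G))⁻¹ * g * (x * c) = h * ((h⁻¹ * c * h)⁻¹ * m * c) := by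
          calc (x * (c : G))⁻¹ * g * (x * c) = (c : G)⁻¹ * (x⁻¹ * g * x) * c := by group
            _ = _ := by rw [← e]; group
        have hmem : (h⁻¹ * c * h)⁻¹ * m * c ∈ N :=
          N.mul_mem (N.mul_mem (N.inv_mem (by simpa using hN.conj_mem c c.2 h⁻¹)) hm) c.2
        rw [h1, Subgroup.mul_mem_cancel_left H hh, ← hf.eq_iff, hc₀, Subtype.ext_iff]
        change _ ↔ (h⁻¹ * c * h) * (c : G)⁻¹ = m
        constructor
        · intro h2
          have h3 : (h⁻¹ * c * h)⁻¹ * m * c = 1 := by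
            have : (h⁻¹ * c * h)⁻¹ * m * c ∈ H ⊓ N := ⟨h2, hmem⟩
            rwa [hHN, Subgroup.mem_bot] at this
          rw [mul_assoc, inv_mul_eq_one] at h3
          rw [h3]; group
        · intro h2
          rw [← h2]
          have : (h⁻¹ * c * h)⁻¹ * (h⁻¹ * c * h * (c : G)⁻¹) * c = 1 := by group
          rw [this]
          exact H.one_mem
      simp only [hiff]
      simp
    · have : IsEmpty {c : N // (x * (c : G))⁻¹ * g * (x * c) ∈ H} := by
        refine ⟨fun c => hx ?_⟩
        have h1 := (H ⊔ N).mul_mem ((H ⊔ N).mul_mem (Subgroup.mem_sup_right c.1.2)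
          (Subgroup.mem_sup_left c.2)) (Subgroup.mem_sup_right (N.inv_mem c.1.2))
        convert h1 using 1
        group
      rw [Nat.card_of_isEmpty, Nat.cast_zero]
  have hsum : (∑ x : D, if (x : G)⁻¹ * g * x ∈ H ⊔ N then (1 : ℚ) else 0) =
      (∑ x : D, if (x : G)⁻¹ * g * x ∈ H then (1 : ℚ) else 0) * Nat.card N := by
    simp only [← key, card_subtype_eq_sum fun c : N => _ ∈ H]
    rw [Finset.sum_comm]
    have : ∀ c : N, (∑ x : D, if ((x : G) * c)⁻¹ * g * (x * c) ∈ H then (1 : ℚ) else 0) =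
        ∑ x : D, if (x : G)⁻¹ * g * x ∈ H then 1 else 0 := by
      intro c
      exact Fintype.sum_equiv (Equiv.mulRight (⟨c, hND c.2⟩ : D)) _ _ fun y => by simp
    simp only [this, Finset.sum_const, nsmul_eq_mul, Finset.card_univ, Nat.card_eq_fintype_card]
    ring
  rw [fixCount_eq_sum, fixCount_eq_sum, hsum, card_sup_of_disjoint hHN, Nat.cast_mul,
    mul_div_mul_right _ _ (card_pos_rat N).ne']

end Counting

/-! ### The operator H ↦ HN on relations -/

section Operators

variable {G : Type u} [Group G]

/-- The operator `H ↦ HN` on combinations of subgroups. -/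
def supHom (N : Subgroup G) : (Subgroup G →₀ ℤ) →+ (Subgroup G →₀ ℤ) :=
  Finsupp.mapDomain.addMonoidHom (· ⊔ N)

@[simp]
theorem supHom_single (N H : Subgroup G) (k : ℤ) :
    supHom N (Finsupp.single H k) = Finsupp.single (H ⊔ N) k := by
  simp [supHom, Finsupp.mapDomain_single]

variable [Finite G]

theorem fixHom_supHom (N : Subgroup G) [N.Normal] [Fintype N] (n : Subgroup G →₀ ℤ) (g : G) :
    fixHom ⊤ g (supHom N n) = (∑ x : N, fixHom ⊤ (g * x) n) / Nat.card N := by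
  induction n using Finsupp.induction_linear with
  | zero => simp
  | add f g hf hg => simp only [map_add, hf, hg, Finset.sum_add_distrib, add_div]
  | single H k =>
    simp only [supHom_single, fixHom_single, fixCount_sup, ← Finset.mul_sum, mul_div_assoc]

theorem supHom_mem_relAbove (N : Subgroup G) [N.Normal] {n : Subgroup G →₀ ℤ}
    (hn : n ∈ relOn (⊤ : Subgroup G)) : supHom N n ∈ relAbove N := by
  classical
  have := Fintype.ofFinite N
  refine ⟨fun H hH => ?_, fun g => ?_⟩
  · obtain ⟨H', -, rfl⟩ := Finset.mem_image.1 (Finsupp.mapDomain_support hH)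
    exact le_sup_right
  · rw [fixHom_supHom, Finset.sum_eq_zero fun x _ => hn.2 _ trivial, zero_div]

theorem relOn_le_relOn_top (D : Subgroup G) : relOn D ≤ relOn (⊤ : Subgroup G) := by
  rintro n ⟨hn, hn'⟩
  have := Fintype.ofFinite G
  rw [mem_relOn_top]
  intro g
  -- For z outside D no D-conjugate of z lies in a subgroup of D, so the induction formula may run
  -- over all of G.
  have hz : ∀ z, fixHom D z n = 0 := by
    intro z
    by_cases hz : z ∈ D
    · exact hn' z hz
    · rw [fixHom_apply]
      refine Finset.sum_eq_zero fun H hH => ?_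
      have : IsEmpty {x : D // (x : G)⁻¹ * z * x ∈ H} := by
        refine ⟨fun x => hz ?_⟩
        have h1 := D.mul_mem (D.mul_mem x.1.2 (hn H hH x.2)) (D.inv_mem x.1.2)
        convert h1 using 1
        group
      simp [fixCount]
  have h1 : fixHom ⊤ g n = (∑ y : G, fixHom D (y⁻¹ * g * y) n) / Nat.card D := by
    simp only [fixHom_apply, Finsupp.sum]
    rw [Finset.sum_comm, Finset.sum_div]
    refine Finset.sum_congr rfl fun H hH => ?_
    rw [fixCount_top_eq_sum D H, ← Finset.mul_sum, mul_div_assoc]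
  rw [h1, Finset.sum_eq_zero fun y _ => hz _, zero_div]

end Operators

/-! ### The subgroups of C and the structure of C ⋊ P -/

variable {G : Type u} [Group G]

/-- The subgroup of `C` generated by the parts of order `l i`, `i ∈ A`. -/
def cycPart (C : Subgroup G) {t : ℕ} (l : Fin t → ℕ) (A : Finset (Fin t)) : Subgroup G :=
  ⨆ i ∈ A, torsionPart C (l i)

/-- `G = C ⋊ P` with `C` cyclic of squarefree order `∏ l i` prime to `p` and `P` a `p`-group
acting faithfully on `C`. -/
structure IsFaithfulSemidirect (p : ℕ) (C P : Subgroup G) {t : ℕ} (l : Fin t → ℕ) : Prop where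
  prime : p.Prime
  normal : C.Normal
  cyclic : IsCyclic C
  isPGroup : IsPGroup p P
  compl : Subgroup.IsComplement' C P
  prime_l : ∀ j, (l j).Prime
  ne_p : ∀ j, l j ≠ p
  injective : Function.Injective l
  card_C : Nat.card C = ∏ j, l j
  faithful : actionKer P C = ⊥

theorem mem_actionKer {P D : Subgroup G} {x : P} :
    x ∈ actionKer P D ↔ ∀ d ∈ D, d * x = x * d := by
  rw [actionKer, Subgroup.mem_subgroupOf, Subgroup.mem_centralizer_iff]
  rfl

theorem mem_Kj {C P : Subgroup G} {t : ℕ} {l : Fin t → ℕ} {j : Fin t} {x : P} :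
    x ∈ Kj C P l j ↔ ∀ i ≠ j, ∀ d ∈ torsionPart C (l i), d * x = x * d := by
  simp only [Kj, Subgroup.mem_iInf, mem_actionKer]

theorem torsionPart_le (C : Subgroup G) (d : ℕ) : torsionPart C d ≤ C := by
  rw [torsionPart, Subgroup.closure_le]
  exact fun c hc => hc.1

theorem cycPart_le (C : Subgroup G) {t : ℕ} (l : Fin t → ℕ) (A : Finset (Fin t)) :
    cycPart C l A ≤ C :=
  iSup₂_le fun i _ => torsionPart_le C (l i)

theorem cycPart_le_iff {C : Subgroup G} {t : ℕ} {l : Fin t → ℕ} {A : Finset (Fin t)}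
    {H : Subgroup G} : cycPart C l A ≤ H ↔ ∀ i ∈ A, torsionPart C (l i) ≤ H :=
  iSup₂_le_iff

theorem torsionPart_le_cycPart {C : Subgroup G} {t : ℕ} {l : Fin t → ℕ} {A : Finset (Fin t)}
    {i : Fin t} (hi : i ∈ A) : torsionPart C (l i) ≤ cycPart C l A :=
  le_iSup₂_of_le i hi le_rfl

@[simp]
theorem cycPart_empty (C : Subgroup G) {t : ℕ} (l : Fin t → ℕ) : cycPart C l ∅ = ⊥ := by
  simp [cycPart]

theorem cycPart_insert (C : Subgroup G) {t : ℕ} (l : Fin t → ℕ) (A : Finset (Fin t)) (i : Fin t) :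
    cycPart C l (insert i A) = cycPart C l A ⊔ torsionPart C (l i) := by
  rw [cycPart, Finset.iSup_insert, sup_comm, cycPart]

theorem mem_Kj_iff {C P : Subgroup G} {t : ℕ} {l : Fin t → ℕ} {i : Fin t} {x : P} : x ∈ Kj C P l i ↔
    ∀ d ∈ cycPart C l (Finset.univ.erase i), d * x = x * d := by
  rw [mem_Kj]
  constructor
  · intro hx d hd
    have hle : cycPart C l (Finset.univ.erase i) ≤ Subgroup.centralizer {(x : G)} := by
      rw [cycPart_le_iff]
      intro k hk d hd
      rw [Subgroup.mem_centralizer_singleton_iff]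
      exact hx k (Finset.ne_of_mem_erase hk) d hd
    exact Subgroup.mem_centralizer_singleton_iff.1 (hle hd)
  · intro hx k hk d hd
    exact hx d (torsionPart_le_cycPart (Finset.mem_erase.2 ⟨hk, Finset.mem_univ _⟩) hd)

/-- An endomorphism of a cyclic group is a power map. Normality in G of all subgroups of C and
commutativity of P both rest on this. -/
theorem exists_conj_eq_zpow {C : Subgroup G} (hC : C.Normal) (hC' : IsCyclic C) (g : G) :
    ∃ m : ℤ, ∀ c ∈ C, g * c * g⁻¹ = c ^ m := by
  obtain ⟨m, hm⟩ := MonoidHom.map_cyclic (MulAut.conjNormal (H := C) g).toMonoidHom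
  refine ⟨m, fun c hc => ?_⟩
  have := congrArg Subtype.val (hm ⟨c, hc⟩)
  simpa using this

theorem normal_of_le_cyclic {C : Subgroup G} (hC : C.Normal) (hC' : IsCyclic C) {V : Subgroup G}
    (hV : V ≤ C) : V.Normal := by
  refine ⟨fun v hv g => ?_⟩
  obtain ⟨m, hm⟩ := exists_conj_eq_zpow hC hC' g
  rw [hm v (hV hv)]
  exact V.zpow_mem hv m

theorem mul_comm_of_mem_cyclic {C : Subgroup G} (hC' : IsCyclic C) {a b : G}
    (ha : a ∈ C) (hb : b ∈ C) : a * b = b * a := by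
  let := IsCyclic.commGroup (α := C)
  exact congrArg Subtype.val (mul_comm (⟨a, ha⟩ : C) ⟨b, hb⟩)

theorem mem_torsionPart {C : Subgroup G} (hC' : IsCyclic C) {d : ℕ} {c : G} :
    c ∈ torsionPart C d ↔ c ∈ C ∧ c ^ d = 1 := by
  refine ⟨fun h => ⟨torsionPart_le C d h, ?_⟩, fun h => Subgroup.subset_closure h⟩
  rw [torsionPart] at h
  have h' : ∀ x ∈ Subgroup.closure {c | c ∈ C ∧ c ^ d = 1}, x ∈ C ∧ x ^ d = 1 := by
    intro x hx
    induction hx using Subgroup.closure_induction with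
    | mem x hx => exact hx
    | one => exact ⟨C.one_mem, one_pow _⟩
    | mul x y _ _ hx hy =>
      refine ⟨C.mul_mem hx.1 hy.1, ?_⟩
      have hxy : Commute x y := mul_comm_of_mem_cyclic hC' hx.1 hy.1
      rw [hxy.mul_pow, hx.2, hy.2, one_mul]
    | inv x _ hx => exact ⟨C.inv_mem hx.1, by rw [inv_pow, hx.2, inv_one]⟩
  exact (h' c h).2

theorem card_torsionPart [Finite G] {C : Subgroup G} (hC' : IsCyclic C) {d : ℕ}
    (hd : d ∣ Nat.card C) : Nat.card (torsionPart C d) = d := by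
  let := IsCyclic.commGroup (α := C)
  have h1 : Nat.card (powMonoidHom d : C →* C).ker = d := by
    rw [IsCyclic.card_powMonoidHom_ker, Nat.gcd_eq_right hd]
  refine Eq.trans (Nat.card_congr ?_) h1
  refine
    { toFun := fun c => ⟨⟨c.1, torsionPart_le C d c.2⟩, ?_⟩
      invFun := fun c => ⟨c.1.1, (mem_torsionPart hC').2 ⟨c.1.2, ?_⟩⟩
      left_inv := fun _ => rfl
      right_inv := fun _ => rfl }
  · rw [MonoidHom.mem_ker]
    exact Subtype.ext ((mem_torsionPart hC').1 c.2).2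
  · exact congrArg Subtype.val (MonoidHom.mem_ker.1 c.2)

namespace IsFaithfulSemidirect

variable [Finite G] {p : ℕ} {C P : Subgroup G} {t : ℕ} {l : Fin t → ℕ}

theorem card_torsionPart (h : IsFaithfulSemidirect p C P l)
    (i : Fin t) : Nat.card (torsionPart C (l i)) = l i :=
  BrauerRel.card_torsionPart h.cyclic (h.card_C ▸ Finset.dvd_prod_of_mem l (Finset.mem_univ i))

theorem normal_of_le (h : IsFaithfulSemidirect p C P l) {V : Subgroup G} (hV : V ≤ C) : V.Normal :=
  normal_of_le_cyclic h.normal h.cyclic hV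

theorem torsionPart_ne_bot (h : IsFaithfulSemidirect p C P l)
    (i : Fin t) : torsionPart C (l i) ≠ ⊥ := by
  intro hb
  have := h.card_torsionPart i
  rw [hb, Subgroup.card_bot] at this
  exact (h.prime_l i).one_lt.ne this

theorem coprime_l (h : IsFaithfulSemidirect p C P l)
    {i j : Fin t} (hij : i ≠ j) : (l i).Coprime (l j) :=
  (Nat.coprime_primes (h.prime_l i) (h.prime_l j)).2 fun e => hij (h.injective e)

theorem card_cycPart (h : IsFaithfulSemidirect p C P l)
    (A : Finset (Fin t)) : Nat.card (cycPart C l A) = ∏ i ∈ A, l i := by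
  induction A using Finset.induction_on with
  | empty => simp
  | insert i A hi ih =>
    have := h.normal_of_le (torsionPart_le C (l i))
    rw [cycPart_insert, card_sup_of_disjoint, ih, h.card_torsionPart, Finset.prod_insert hi,
      mul_comm]
    refine (Subgroup.disjoint_of_coprime_natCard ?_).eq_bot
    rw [ih, h.card_torsionPart]
    exact Nat.Coprime.prod_left fun j hj => h.coprime_l fun e => hi (e ▸ hj)

theorem cycPart_univ (h : IsFaithfulSemidirect p C P l) : cycPart C l Finset.univ = C :=
  Subgroup.eq_of_le_of_card_ge (cycPart_le C l _) (by rw [h.card_cycPart, h.card_C])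

theorem torsionPart_le_cycPart_iff (h : IsFaithfulSemidirect p C P l)
    {i : Fin t} {A : Finset (Fin t)} :
    torsionPart C (l i) ≤ cycPart C l A ↔ i ∈ A := by
  refine ⟨fun hle => ?_, torsionPart_le_cycPart⟩
  have := Subgroup.card_dvd_of_le hle
  rw [h.card_torsionPart, h.card_cycPart, (h.prime_l i).prime.dvd_finsetProd_iff] at this
  obtain ⟨j, hj, hij⟩ := this
  rwa [h.injective ((Nat.prime_dvd_prime_iff_eq (h.prime_l i) (h.prime_l j)).1 hij)]

theorem torsionPart_le_of_dvd (h : IsFaithfulSemidirect p C P l)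
    {V : Subgroup G} (hV : V ≤ C) {i : Fin t} (hi : l i ∣ Nat.card V) :
    torsionPart C (l i) ≤ V := by
  have := Fact.mk (h.prime_l i)
  obtain ⟨v, hv⟩ := exists_prime_orderOf_dvd_card' (l i) hi
  have hle : Subgroup.zpowers (v : G) ≤ torsionPart C (l i) := by
    rw [Subgroup.zpowers_le, mem_torsionPart h.cyclic]
    exact ⟨hV v.2, by rw [← hv]; exact_mod_cast congrArg Subtype.val (pow_orderOf_eq_one v)⟩
  have heq : Subgroup.zpowers (v : G) = torsionPart C (l i) := by
    refine Subgroup.eq_of_le_of_card_ge hle ?_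
    rw [h.card_torsionPart, Nat.card_zpowers, Subgroup.orderOf_coe, hv]
  rw [← heq, Subgroup.zpowers_le]
  exact v.2

-- As |C| is squarefree, a subgroup V is determined by the primes dividing its order, and by Cauchy
-- l_i divides |V| only if C_{l_i} ≤ V.
open Classical in
theorem eq_cycPart (h : IsFaithfulSemidirect p C P l) {V : Subgroup G} (hV : V ≤ C) :
    V = cycPart C l {i | torsionPart C (l i) ≤ V} := by
  symm
  refine Subgroup.eq_of_le_of_card_ge (cycPart_le_iff.2 fun i hi => by simpa using hi) ?_
  rw [h.card_cycPart]
  refine Nat.le_of_dvd (Finset.prod_pos fun i _ => (h.prime_l i).pos) ?_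
  have h1 : Nat.card V ∣ (∏ i with torsionPart C (l i) ≤ V, l i) *
      ∏ i with ¬ torsionPart C (l i) ≤ V, l i := by
    rw [Finset.prod_filter_mul_prod_filter_not, ← h.card_C]
    exact Subgroup.card_dvd_of_le hV
  refine Nat.Coprime.dvd_of_dvd_mul_right ?_ h1
  refine Nat.Coprime.prod_right fun i hi => ?_
  rw [Nat.coprime_comm, (h.prime_l i).coprime_iff_not_dvd]
  exact fun hdvd => (Finset.mem_filter.1 hi).2 (h.torsionPart_le_of_dvd hV hdvd)

theorem cycPart_injective (h : IsFaithfulSemidirect p C P l)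
    : Function.Injective (cycPart C l) := by
  intro A B hAB
  ext i
  rw [← h.torsionPart_le_cycPart_iff, hAB, h.torsionPart_le_cycPart_iff]

theorem exists_torsionPart_le (h : IsFaithfulSemidirect p C P l) {H : Subgroup G} (hH : H ⊓ C ≠ ⊥) :
    ∃ i, torsionPart C (l i) ≤ H := by
  classical
  by_contra! hc
  apply hH
  rw [h.eq_cycPart (inf_le_right : H ⊓ C ≤ C), Finset.filter_false_of_mem, cycPart_empty]
  exact fun i _ hle => hc i (hle.trans inf_le_left)

theorem inf_le_cycPart_erase (h : IsFaithfulSemidirect p C P l)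
    {D : Subgroup G} {i : Fin t} (hi : ¬ torsionPart C (l i) ≤ D) :
    D ⊓ C ≤ cycPart C l (Finset.univ.erase i) := by
  classical
  rw [h.eq_cycPart (inf_le_right : D ⊓ C ≤ C), cycPart_le_iff]
  intro j hj
  refine torsionPart_le_cycPart (Finset.mem_erase.2 ⟨?_, Finset.mem_univ _⟩)
  rintro rfl
  exact hi ((Finset.mem_filter.1 hj).2.trans inf_le_left)

theorem inf_torsionPart_eq_bot (h : IsFaithfulSemidirect p C P l)
    {H : Subgroup G} {i : Fin t} (hi : ¬ torsionPart C (l i) ≤ H) :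
    H ⊓ torsionPart C (l i) = ⊥ := by
  have := Subgroup.card_dvd_of_le (inf_le_right : H ⊓ torsionPart C (l i) ≤ _)
  rw [h.card_torsionPart, Nat.dvd_prime (h.prime_l i)] at this
  rcases this with h1 | h1
  · exact Subgroup.eq_bot_of_card_eq _ h1
  · refine absurd ?_ hi
    rw [← inf_eq_right]
    exact Subgroup.eq_of_le_of_card_ge inf_le_right (by rw [h1, h.card_torsionPart])

/-- Subgroups of C correspond to sets of indices, and μ of a product of |A| distinct primes is
(-1)^|A|. -/
theorem sum_subgroup_moebius (h : IsFaithfulSemidirect p C P l)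
    {A : Type*} [AddCommGroup A] (f : Subgroup G → A) :
    ∑ᶠ U : Subgroup C, ArithmeticFunction.moebius (Nat.card U) • f (U.map C.subtype) =
      ∑ A : Finset (Fin t), (-1 : ℤ) ^ A.card • f (cycPart C l A) := by
  classical
  let e : Finset (Fin t) → Subgroup C := fun A => (cycPart C l A).subgroupOf C
  have hmap : ∀ A, (e A).map C.subtype = cycPart C l A := fun A => by
    simpa [e] using cycPart_le C l A
  have he : Function.Bijective e := by
    constructor
    · intro A B hAB
      apply h.cycPart_injective
      rw [← hmap, ← hmap, hAB]
    · intro U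
      refine ⟨Finset.univ.filter fun i => torsionPart C (l i) ≤ U.map C.subtype, ?_⟩
      apply Subgroup.map_injective C.subtype_injective
      rw [hmap, ← h.eq_cycPart (Subgroup.map_subtype_le U)]
  rw [← finsum_eq_sum_of_fintype]
  refine (finsum_eq_of_bijective e he fun A => ?_).symm
  have hcard : Nat.card (e A) = ∏ i ∈ A, l i := by
    rw [← h.card_cycPart, ← hmap]
    exact Nat.card_congr ((e A).equivMapOfInjective _ C.subtype_injective).toEquiv
  have hmu : ∀ B : Finset (Fin t),
      ArithmeticFunction.moebius (∏ i ∈ B, l i) = (-1 : ℤ) ^ B.card := by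
    intro B
    induction B using Finset.induction_on with
    | empty => simp
    | insert i B hi ih =>
      rw [Finset.prod_insert hi, ArithmeticFunction.isMultiplicative_moebius.map_mul_of_coprime, ih,
        ArithmeticFunction.moebius_apply_prime (h.prime_l i), Finset.card_insert_of_notMem hi]
      · ring
      · exact Nat.Coprime.prod_right fun j hj => h.coprime_l fun e => hi (e ▸ hj)
  rw [hmap, hcard, hmu]

theorem card_mul_card (h : IsFaithfulSemidirect p C P l)
    : Nat.card C * Nat.card P = Nat.card G := h.compl.card_mul_card

theorem coprime_card_p (h : IsFaithfulSemidirect p C P l) : (Nat.card C).Coprime p := by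
  rw [h.card_C]
  exact Nat.Coprime.prod_left fun i _ =>
    (Nat.coprime_primes (h.prime_l i) h.prime).2 (h.ne_p i)

theorem eq_one_of_mem_C (h : IsFaithfulSemidirect p C P l)
    {c : G} (hc : c ∈ C) {k : ℕ} (hk : c ^ p ^ k = 1) : c = 1 := by
  have h1 : orderOf c ∣ Nat.card C := by
    rw [← Subgroup.orderOf_mk c hc]; exact orderOf_dvd_natCard _
  have h2 := orderOf_dvd_of_pow_eq_one hk
  rw [← orderOf_eq_one_iff]
  exact Nat.eq_one_of_dvd_coprimes (h.coprime_card_p.pow_right k) h1 h2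

theorem exists_pow_eq_one (h : IsFaithfulSemidirect p C P l)
    {x : G} (hx : x ∈ P) : ∃ k : ℕ, x ^ p ^ k = 1 := by
  obtain ⟨k, hk⟩ := h.isPGroup ⟨x, hx⟩
  exact ⟨k, congrArg Subtype.val hk⟩

theorem eq_one_of_mem_both (h : IsFaithfulSemidirect p C P l)
    {x : G} (hx : x ∈ P) (hx' : x ∈ C) : x = 1 := by
  obtain ⟨k, hk⟩ := h.exists_pow_eq_one hx
  exact h.eq_one_of_mem_C hx' hk

theorem exists_mul_eq (h : IsFaithfulSemidirect p C P l) (g : G) : ∃ c ∈ C, ∃ x ∈ P, c * x = g := by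
  have := h.normal
  have hg : g ∈ C ⊔ P := h.compl.sup_eq_top ▸ Subgroup.mem_top g
  exact Subgroup.mem_sup_of_normal_left.1 hg

theorem eq_one_of_centralizes (h : IsFaithfulSemidirect p C P l)
    {x : G} (hx : x ∈ P) (hc : ∀ c ∈ C, c * x = x * c) : x = 1 := by
  have : (⟨x, hx⟩ : P) ∈ actionKer P C := mem_actionKer.2 hc
  rw [h.faithful, Subgroup.mem_bot] at this
  exact congrArg Subtype.val this

theorem mem_C_of_centralizes (h : IsFaithfulSemidirect p C P l)
    {g : G} (hg : ∀ c ∈ C, c * g = g * c) : g ∈ C := by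
  obtain ⟨a, ha, x, hx, rfl⟩ := h.exists_mul_eq g
  have : x = 1 := by
    refine h.eq_one_of_centralizes hx fun c hc => ?_
    have h1 := hg c hc
    rw [← mul_assoc, mul_comm_of_mem_cyclic h.cyclic hc ha, mul_assoc, mul_assoc] at h1
    exact mul_left_cancel h1
  rw [this, mul_one]
  exact ha

/-- Power maps of C commute, so the commutator of x and y centralises C and is trivial by
faithfulness. -/
theorem commute_of_mem_P (h : IsFaithfulSemidirect p C P l)
    {x y : G} (hx : x ∈ P) (hy : y ∈ P) : x * y = y * x := by
  have h1 : x * y * x⁻¹ * y⁻¹ = 1 := by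
    refine h.eq_one_of_centralizes
      (P.mul_mem (P.mul_mem (P.mul_mem hx hy) (P.inv_mem hx)) (P.inv_mem hy)) fun c hc => ?_
    have hN := h.normal
    have hd : (y * x) * ((y * x)⁻¹ * c * (y * x)) * (y * x)⁻¹ = c := by group
    have hd' : (y * x)⁻¹ * c * (y * x) ∈ C := by simpa using hN.conj_mem c hc (y * x)⁻¹
    have key2 : x * y * ((y * x)⁻¹ * c * (y * x)) * (x * y)⁻¹ = c := by
      obtain ⟨m, hm⟩ := exists_conj_eq_zpow h.normal h.cyclic x
      obtain ⟨k, hk⟩ := exists_conj_eq_zpow h.normal h.cyclic y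
      generalize (y * x)⁻¹ * c * (y * x) = d at hd hd' ⊢
      have e1 : x * y * d * (x * y)⁻¹ = x * (y * d * y⁻¹) * x⁻¹ := by group
      have e2 : y * x * d * (y * x)⁻¹ = y * (x * d * x⁻¹) * y⁻¹ := by group
      rw [← hd, e1, e2, hm _ (hN.conj_mem d hd' y), hk _ (hN.conj_mem d hd' x), hk d hd', hm d hd',
        ← zpow_mul, ← zpow_mul, mul_comm]
    have e3 : x * y * x⁻¹ * y⁻¹ * c = x * y * ((y * x)⁻¹ * c * (y * x)) * (x * y)⁻¹ *
      (x * y * x⁻¹ * y⁻¹) := by group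
    rw [e3, key2]
  have h2 : x * y = 1 * (y * x) := by rw [← h1]; group
  rw [h2, one_mul]

theorem commutator_mem (h : IsFaithfulSemidirect p C P l) (g k : G) : g * k * g⁻¹ * k⁻¹ ∈ C := by
  have := h.normal
  rw [← QuotientGroup.eq_one_iff (N := C)]
  have hrep : ∀ g : G, ∃ x ∈ P, (g : G ⧸ C) = x := by
    intro g
    obtain ⟨c, hc, x, hx, rfl⟩ := h.exists_mul_eq g
    refine ⟨x, hx, ?_⟩
    rw [QuotientGroup.mk_mul, (QuotientGroup.eq_one_iff c).2 hc, one_mul]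
  obtain ⟨x, hx, ex⟩ := hrep g
  obtain ⟨y, hy, ey⟩ := hrep k
  simp only [QuotientGroup.mk_mul, QuotientGroup.mk_inv, ex, ey]
  rw [← QuotientGroup.mk_mul, h.commute_of_mem_P hx hy, QuotientGroup.mk_mul]
  group

/-- G/C is abelian, so the image of H there does not change under conjugation. This makes `detect` a
function of the conjugacy class. -/
theorem sup_C_conj (h : IsFaithfulSemidirect p C P l) (H : Subgroup G) (g : G) :
    H.map (MulAut.conj g).toMonoidHom ⊔ C = H ⊔ C := by
  have key : ∀ (H : Subgroup G) (g : G), H.map (MulAut.conj g).toMonoidHom ≤ H ⊔ C := by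
    rintro H g _ ⟨x, hx, rfl⟩
    have h1 := (H ⊔ C).mul_mem (Subgroup.mem_sup_right (h.commutator_mem g x))
      (Subgroup.mem_sup_left hx)
    simpa using h1
  refine le_antisymm (sup_le (key H g) le_sup_right) (sup_le ?_ le_sup_right)
  have h1 := key (H.map (MulAut.conj g).toMonoidHom) g⁻¹
  rw [Subgroup.map_map] at h1
  refine le_trans (fun x hx => ?_) h1
  exact ⟨x, hx, by simp [mul_assoc]⟩

theorem normal_sup_C (h : IsFaithfulSemidirect p C P l) (H : Subgroup G) : (H ⊔ C).Normal := by
  refine ⟨fun x hx g => ?_⟩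
  have h1 := (H ⊔ C).mul_mem (Subgroup.mem_sup_right (h.commutator_mem g x)) hx
  simpa using h1

theorem not_dvd_index (h : IsFaithfulSemidirect p C P l) : ¬ p ∣ P.index := by
  rw [h.compl.index_eq_card]
  exact (h.prime.coprime_iff_not_dvd).1 h.coprime_card_p.symm

theorem exists_conj_le (h : IsFaithfulSemidirect p C P l) {Q : Subgroup G} (hQ : IsPGroup p Q) :
    ∃ g : G, Q.map (MulAut.conj g).toMonoidHom ≤ P := by
  have := Fact.mk h.prime
  obtain ⟨R, hR⟩ := hQ.exists_le_sylow
  obtain ⟨g, hg⟩ := MulAction.exists_smul_eq G R (h.isPGroup.toSylow h.not_dvd_index)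
  refine ⟨g, ?_⟩
  have h1 : ((g • R : Sylow p G) : Subgroup G) = P := by rw [hg]; rfl
  rw [← h1]
  exact Subgroup.map_mono hR

theorem card_mul_card_C_eq (h : IsFaithfulSemidirect p C P l) {H : Subgroup G} (hH : H ⊓ C = ⊥) :
    Nat.card (H ⊔ C : Subgroup G) = Nat.card H * Nat.card C := by
  have := h.normal
  exact card_sup_of_disjoint hH

theorem card_dvd_of_inf (h : IsFaithfulSemidirect p C P l)
    {H : Subgroup G} (hH : H ⊓ C = ⊥) : Nat.card H ∣ Nat.card P := by
  have h1 := Subgroup.card_subgroup_dvd_card (H ⊔ C)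
  rw [h.card_mul_card_C_eq hH, ← h.card_mul_card, mul_comm] at h1
  exact Nat.dvd_of_mul_dvd_mul_left Nat.card_pos h1

/-- Such an H embeds into G/C, a group of order |P|. -/
theorem isPGroup_of_inf (h : IsFaithfulSemidirect p C P l)
    {H : Subgroup G} (hH : H ⊓ C = ⊥) : IsPGroup p H := by
  have := Fact.mk h.prime
  obtain ⟨k, hk⟩ := h.isPGroup.exists_card_eq
  have h1 := h.card_dvd_of_inf hH
  rw [hk, Nat.dvd_prime_pow h.prime] at h1
  obtain ⟨m, -, hm⟩ := h1
  exact IsPGroup.of_card hm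

theorem inf_C_of_isPGroup (h : IsFaithfulSemidirect p C P l)
    {H : Subgroup G} (hH : IsPGroup p H) : H ⊓ C = ⊥ := by
  rw [eq_bot_iff]
  rintro x ⟨hx, hx'⟩
  obtain ⟨k, hk⟩ := hH ⟨x, hx⟩
  exact h.eq_one_of_mem_C hx' (congrArg Subtype.val hk)

theorem inf_C_of_card_dvd (h : IsFaithfulSemidirect p C P l)
    {H : Subgroup G} (hH : Nat.card H ∣ Nat.card P) : H ⊓ C = ⊥ := by
  have := Fact.mk h.prime
  obtain ⟨k, hk⟩ := h.isPGroup.exists_card_eq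
  rw [hk, Nat.dvd_prime_pow h.prime] at hH
  obtain ⟨m, -, hm⟩ := hH
  exact h.inf_C_of_isPGroup (IsPGroup.of_card hm)

/-- A common element centralises every C_{l_k}, hence C. This is how the assumption t > 1 enters. -/
theorem Kj_inf_Kj (h : IsFaithfulSemidirect p C P l)
    {i j : Fin t} (hij : i ≠ j) : Kj C P l i ⊓ Kj C P l j = ⊥ := by
  rw [eq_bot_iff]
  rintro ⟨x, hx⟩ ⟨hi, hj⟩
  refine Subtype.ext (h.eq_one_of_centralizes hx ?_)
  have hle : C ≤ Subgroup.centralizer {x} := by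
    conv_lhs => rw [← h.cycPart_univ]
    rw [cycPart_le_iff]
    intro k _ d hd
    rw [Subgroup.mem_centralizer_singleton_iff]
    by_cases hk : k = i
    · exact mem_Kj.1 hj k (hk ▸ hij) d hd
    · exact mem_Kj.1 hi k hk d hd
  intro c hc
  exact Subgroup.mem_centralizer_singleton_iff.1 (hle hc)

/-- K_i is trivial on the other C_{l_k}, so it acts faithfully on C_{l_i}, whose automorphism group
is cyclic because l_i is prime. -/
theorem isCyclic_Kj (h : IsFaithfulSemidirect p C P l) (i : Fin t) : IsCyclic (Kj C P l i) := by
  have hN := h.normal_of_le (torsionPart_le C (l i))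
  have hcard := h.card_torsionPart i
  have := Fact.mk (h.prime_l i)
  have hcyc : IsCyclic (torsionPart C (l i)) := isCyclic_of_prime_card hcard
  have : IsCyclic (MulAut (torsionPart C (l i))) := by
    have e := IsCyclic.mulAutMulEquiv (torsionPart C (l i))
    rw [hcard] at e
    exact isCyclic_of_injective e.toMonoidHom e.injective
  let f : Kj C P l i →* MulAut (torsionPart C (l i)) :=
    (MulAut.conjNormal (H := torsionPart C (l i))).comp (P.subtype.comp (Kj C P l i).subtype)
  refine isCyclic_of_injective f ((injective_iff_map_eq_one f).2 fun x hx => ?_)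
  have hc : ∀ d ∈ torsionPart C (l i), d * (x : G) = x * d := by
    intro d hd
    have h1 := congrArg Subtype.val (DFunLike.congr_fun hx ⟨d, hd⟩)
    have h2 : (x : G) * d * (x : G)⁻¹ = d := by simpa [f] using h1
    rw [mul_inv_eq_iff_eq_mul] at h2
    exact h2.symm
  refine Subtype.ext (Subtype.ext (h.eq_one_of_centralizes x.1.2 ?_))
  have hle : C ≤ Subgroup.centralizer {(x : G)} := by
    conv_lhs => rw [← h.cycPart_univ]
    rw [cycPart_le_iff]
    intro k _ d hd
    rw [Subgroup.mem_centralizer_singleton_iff]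
    by_cases hk : k = i
    · exact hc d (hk ▸ hd)
    · exact mem_Kj.1 x.2 k hk d hd
  intro c hc
  exact Subgroup.mem_centralizer_singleton_iff.1 (hle hc)

end IsFaithfulSemidirect

/-! ### Masses and alternating sums over the subgroups of C -/

section Operators

/-- The total mass `∑ n_H / |H|` of a combination at the subgroups containing `x`. -/
def massAt (x : G) : (Subgroup G →₀ ℤ) →+ ℚ :=
  open Classical in
  Finsupp.liftAddHom fun H => zmultiplesHom ℚ (if x ∈ H then (1 : ℚ) / Nat.card H else 0)

open Classical in
theorem massAt_single (x : G) (H : Subgroup G) (k : ℤ) :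
    massAt x (Finsupp.single H k) = k * if x ∈ H then (1 : ℚ) / Nat.card H else 0 := by
  simp [massAt]

open Classical in
theorem massAt_apply (x : G) (n : Subgroup G →₀ ℤ) :
    massAt x n = n.sum fun H k => k * if x ∈ H then (1 : ℚ) / Nat.card H else 0 := by
  rw [massAt, Finsupp.liftAddHom_apply]
  exact Finsupp.sum_congr fun H _ => by simp

/-- The operator `H ↦ ∑_{A ⊆ S} (-1)^{|A|} H C_A`. -/
def altHom (C : Subgroup G) {t : ℕ} (l : Fin t → ℕ) (S : Finset (Fin t)) :
    (Subgroup G →₀ ℤ) →+ (Subgroup G →₀ ℤ) :=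
  ∑ A ∈ S.powerset, (-1 : ℤ) ^ A.card • supHom (cycPart C l A)

variable {C : Subgroup G} {t : ℕ} {l : Fin t → ℕ}

theorem altHom_apply (S : Finset (Fin t)) (n : Subgroup G →₀ ℤ) :
    altHom C l S n = ∑ A ∈ S.powerset, (-1 : ℤ) ^ A.card • supHom (cycPart C l A) n := by
  simp [altHom, AddMonoidHom.finsetSum_apply]

theorem altHom_single (S : Finset (Fin t)) (H : Subgroup G) (k : ℤ) :
    altHom C l S (Finsupp.single H k) =
      ∑ A ∈ S.powerset, (-1 : ℤ) ^ A.card • Finsupp.single (H ⊔ cycPart C l A) k := by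
  simp only [altHom_apply, supHom_single]

theorem supHom_supHom (N M : Subgroup G) (n : Subgroup G →₀ ℤ) :
    supHom N (supHom M n) = supHom (M ⊔ N) n := by
  induction n using Finsupp.induction_linear with
  | zero => simp
  | add f g hf hg => simp only [map_add, hf, hg]
  | single H k => simp only [supHom_single, sup_assoc]

/-- `altHom` is a product of factors 1 - (H ↦ H·C_{l_i}); later arguments split off the one factor
that matters. -/
theorem altHom_insert {S : Finset (Fin t)} {i : Fin t} (hi : i ∉ S) (n : Subgroup G →₀ ℤ) :
    altHom C l (insert i S) n =
      altHom C l S n - supHom (torsionPart C (l i)) (altHom C l S n) := by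
  simp only [altHom_apply]
  rw [Finset.sum_powerset_insert hi, map_sum, sub_eq_add_neg, ← Finset.sum_neg_distrib]
  congr 1
  refine Finset.sum_congr rfl fun A hA => ?_
  rw [Finset.card_insert_of_notMem fun h => hi (Finset.mem_powerset.1 hA h), map_zsmul,
    supHom_supHom, cycPart_insert, pow_succ, mul_neg_one, neg_smul]

theorem le_of_mem_support_altHom {D : Subgroup G} {S : Finset (Fin t)} (hS : cycPart C l S ≤ D)
    {m : Subgroup G →₀ ℤ} (hm : ∀ H ∈ m.support, H ≤ D) :
    ∀ H ∈ (altHom C l S m).support, H ≤ D := by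
  classical
  intro H hH
  rw [altHom_apply] at hH
  obtain ⟨A, hA, hH⟩ := Finset.mem_biUnion.1 (Finsupp.support_finsetSum hH)
  obtain ⟨H', hH', rfl⟩ := Finset.mem_image.1
    (Finsupp.mapDomain_support (Finsupp.support_smul hH))
  refine sup_le (hm _ hH') ((cycPart_le_iff.2 fun i hi => ?_).trans hS)
  exact torsionPart_le_cycPart (Finset.mem_powerset.1 hA hi)

end Operators

/-! ### Relations obtained from alternating sums -/

namespace IsFaithfulSemidirect

variable [Finite G] {p : ℕ} {C P : Subgroup G} {t : ℕ} {l : Fin t → ℕ}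

theorem altHom_mem_relOn_top (h : IsFaithfulSemidirect p C P l)
    (S : Finset (Fin t)) {n : Subgroup G →₀ ℤ}
    (hn : n ∈ relOn (⊤ : Subgroup G)) : altHom C l S n ∈ relOn (⊤ : Subgroup G) := by
  rw [altHom_apply]
  refine AddSubgroup.sum_mem _ fun A _ => AddSubgroup.zsmul_mem _ ?_ _
  have := h.normal_of_le (cycPart_le C l A)
  rw [mem_relOn_top]
  exact (supHom_mem_relAbove _ hn).2

theorem toBurnside_supHom_mem_imprimitive (h : IsFaithfulSemidirect p C P l)
    (i : Fin t) {n : Subgroup G →₀ ℤ}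
    (hn : n ∈ relOn (⊤ : Subgroup G)) :
    toBurnside (supHom (torsionPart C (l i)) n) ∈ imprimitive G := by
  have := h.normal_of_le (torsionPart_le C (l i))
  exact toBurnside_mem_imprimitive_of_relAbove this (h.torsionPart_ne_bot i)
    (supHom_mem_relAbove _ hn)

theorem toBurnside_sub_altHom_mem (h : IsFaithfulSemidirect p C P l)
    (S : Finset (Fin t)) {n : Subgroup G →₀ ℤ}
    (hn : n ∈ relOn (⊤ : Subgroup G)) :
    toBurnside (n - altHom C l S n) ∈ imprimitive G := by
  induction S using Finset.induction_on with
  | empty =>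
    have : altHom C l ∅ n = n := by
      simp only [altHom_apply, Finset.powerset_empty, Finset.sum_singleton, Finset.card_empty,
        pow_zero, one_smul, cycPart_empty, supHom, sup_bot_eq]
      exact Finsupp.mapDomain_id
    rw [this, sub_self, map_zero]
    exact AddSubgroup.zero_mem _
  | insert i S hi ih =>
    rw [altHom_insert hi, ← sub_add, map_add]
    exact AddSubgroup.add_mem _ ih
      (h.toBurnside_supHom_mem_imprimitive i (h.altHom_mem_relOn_top S hn))

/-- H contains some C_{l_i}, and the factor of index i then annihilates every term. -/
theorem altHom_univ_single_eq_zero (h : IsFaithfulSemidirect p C P l)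
    {H : Subgroup G} (hH : H ⊓ C ≠ ⊥) (k : ℤ) :
    altHom C l Finset.univ (Finsupp.single H k) = 0 := by
  obtain ⟨i, hi⟩ := h.exists_torsionPart_le hH
  rw [← Finset.insert_erase (Finset.mem_univ i), altHom_insert (Finset.notMem_erase i _),
    altHom_single, map_sum, ← Finset.sum_sub_distrib]
  refine Finset.sum_eq_zero fun A _ => ?_
  rw [map_zsmul, supHom_single, sup_eq_left.2 (hi.trans le_sup_left), sub_self]

theorem not_torsionPart_le_sup (h : IsFaithfulSemidirect p C P l)
    {Q : Subgroup G} (hQ : Q ≤ P) {A : Finset (Fin t)} {i : Fin t}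
    (hi : i ∉ A) : ¬ torsionPart C (l i) ≤ Q ⊔ cycPart C l A := by
  intro hle
  have hN := h.normal_of_le (cycPart_le C l A)
  apply hi
  rw [← h.torsionPart_le_cycPart_iff]
  intro c hc
  obtain ⟨q, hq, u, hu, rfl⟩ := Subgroup.mem_sup_of_normal_right.1 (hle hc)
  have hu' := cycPart_le C l A hu
  have : q = 1 := h.eq_one_of_mem_both (hQ hq)
    ((Subgroup.mul_mem_cancel_right C hu').1 (torsionPart_le C _ hc))
  rwa [this, one_mul]

/-- An element moving something in C_{l_i} fixes only 1 there, the order being prime; hence the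
terms for A and A ∪ {i} have equal characters and opposite signs. -/
theorem fixHom_altHom_eq_zero (h : IsFaithfulSemidirect p C P l)
    {D Q : Subgroup G} (hQ : Q ≤ P) {S : Finset (Fin t)}
    (hS : cycPart C l S ≤ D) {d : G} {i : Fin t} (hi : i ∈ S)
    (hd : ¬ ∀ c ∈ torsionPart C (l i), c * d = d * c) (k : ℤ) :
    fixHom D d (altHom C l S (Finsupp.single Q k)) = 0 := by
  rw [← Finset.insert_erase hi, altHom_insert (Finset.notMem_erase i _),
    altHom_single, map_sum, map_sub, map_sum, map_sum, ← Finset.sum_sub_distrib]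
  refine Finset.sum_eq_zero fun A hA => ?_
  have hiA : i ∉ A := fun hiA => Finset.notMem_erase i _ (Finset.mem_powerset.1 hA hiA)
  have hN := h.normal_of_le (torsionPart_le C (l i))
  rw [map_zsmul, map_zsmul, map_zsmul, supHom_single, fixHom_single, fixHom_single,
    fixCount_sup_of_fixedPointFree ((torsionPart_le_cycPart hi).trans hS)
      (fun a ha b hb => mul_comm_of_mem_cyclic h.cyclic (torsionPart_le C _ ha)
        (torsionPart_le C _ hb))
      (h.inf_torsionPart_eq_bot (h.not_torsionPart_le_sup hQ hiA)), sub_self]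
  intro c hc hcd
  have hcent : ¬ torsionPart C (l i) ≤ Subgroup.centralizer {d} := fun hle =>
    hd fun c hc => Subgroup.mem_centralizer_singleton_iff.1 (hle hc)
  have : c ∈ Subgroup.centralizer {d} ⊓ torsionPart C (l i) :=
    ⟨Subgroup.mem_centralizer_singleton_iff.2 hcd, hc⟩
  rwa [h.inf_torsionPart_eq_bot hcent, Subgroup.mem_bot] at this

theorem mul_mem_sup_iff (h : IsFaithfulSemidirect p C P l)
    {Q : Subgroup G} (hQ : Q ≤ P) {V : Subgroup G} (hV : V ≤ C) {x c : G}
    (hx : x ∈ P) (hc : c ∈ C) : x * c ∈ Q ⊔ V ↔ x ∈ Q ∧ c ∈ V := by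
  have hN := h.normal_of_le hV
  rw [Subgroup.mem_sup_of_normal_right]
  constructor
  · rintro ⟨q, hq, u, hu, e⟩
    have e' : q⁻¹ * x = u * c⁻¹ := by
      rw [inv_mul_eq_iff_eq_mul, ← mul_assoc, e, mul_inv_cancel_right]
    have h1 : q⁻¹ * x = 1 := by
      refine h.eq_one_of_mem_both (P.mul_mem (P.inv_mem (hQ hq)) hx) ?_
      rw [e']
      exact C.mul_mem (hV hu) (C.inv_mem hc)
    rw [h1, eq_comm, mul_inv_eq_one] at e'
    rw [inv_mul_eq_one] at h1
    exact ⟨h1 ▸ hq, e' ▸ hu⟩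
  · rintro ⟨h1, h2⟩
    exact ⟨x, h1, c, h2, rfl⟩

theorem card_sup_of_le (h : IsFaithfulSemidirect p C P l)
    {Q : Subgroup G} (hQ : Q ≤ P) {V : Subgroup G} (hV : V ≤ C) :
    Nat.card (Q ⊔ V : Subgroup G) = Nat.card Q * Nat.card V := by
  have hN := h.normal_of_le hV
  refine card_sup_of_disjoint ?_
  rw [eq_bot_iff]
  exact fun x hx => h.eq_one_of_mem_both (hQ hx.1) (hV hx.2)

-- Since x is central in R·C_S, membership of xc in Q·C_A is invariant under conjugation and splits
-- into x ∈ Q and c ∈ C_A. The sum factors, and the second factor does not involve Q.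
open Classical in
theorem fixHom_altHom (h : IsFaithfulSemidirect p C P l)
    {R Q : Subgroup G} (hR : R ≤ P) (hQ : Q ≤ R) {S : Finset (Fin t)}
    {x c : G} (hx : x ∈ R) (hc : c ∈ cycPart C l S)
    (hd : ∀ u ∈ cycPart C l S, u * x = x * u) (k : ℤ) :
    fixHom (R ⊔ cycPart C l S) (x * c) (altHom C l S (Finsupp.single Q k)) =
      massAt x (Finsupp.single Q k) *
        ∑ A ∈ S.powerset, (-1 : ℚ) ^ A.card *
          if c ∈ cycPart C l A then
            (Nat.card (R ⊔ cycPart C l S : Subgroup G) : ℚ) / Nat.card (cycPart C l A) else 0 := by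
  have hcC := cycPart_le C l S hc
  have hxD : ∀ y ∈ R ⊔ cycPart C l S, y * x = x * y := by
    have hle : R ⊔ cycPart C l S ≤ Subgroup.centralizer {x} := by
      refine sup_le (fun r hr => ?_) fun u hu => ?_
      · exact Subgroup.mem_centralizer_singleton_iff.2 (h.commute_of_mem_P (hR hr) (hR hx))
      · exact Subgroup.mem_centralizer_singleton_iff.2 (hd u hu)
    exact fun y hy => Subgroup.mem_centralizer_singleton_iff.1 (hle hy)
  rw [altHom_single, map_sum, massAt_single, Finset.mul_sum]
  refine Finset.sum_congr rfl fun A _ => ?_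
  have hV := cycPart_le C l A
  have hN := h.normal_of_le hV
  have hNC := h.normal
  rw [map_zsmul, fixHom_single, fixCount_of_conj_mem_iff, h.card_sup_of_le (hQ.trans hR) hV,
    h.mul_mem_sup_iff (hQ.trans hR) hV (hR hx) hcC]
  · by_cases h1 : x ∈ Q <;> by_cases h2 : c ∈ cycPart C l A <;> simp [h1, h2]
    field_simp
  · intro y hy
    have e : y⁻¹ * (x * c) * y = x * (y⁻¹ * c * y) := by
      have e1 := hxD y hy
      calc y⁻¹ * (x * c) * y = y⁻¹ * (x * y) * (y⁻¹ * c * y) := by group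
        _ = x * (y⁻¹ * c * y) := by rw [← e1]; group
    have hcy : y⁻¹ * c * y ∈ C := by simpa using hNC.conj_mem c hcC y⁻¹
    rw [e, h.mul_mem_sup_iff (hQ.trans hR) hV (hR hx) hcy,
      h.mul_mem_sup_iff (hQ.trans hR) hV (hR hx) hcC]
    refine and_congr_right fun _ => ⟨fun h1 => ?_, fun h1 => ?_⟩
    · have := hN.conj_mem _ h1 y
      have e2 : y * (y⁻¹ * c * y) * y⁻¹ = c := by group
      rwa [e2] at this
    · simpa using hN.conj_mem c h1 y⁻¹

/-- A criterion for the alternating sums over `A ⊆ S` to be relations of `R ⋉ C_S`. -/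
theorem altHom_mem_relOn (h : IsFaithfulSemidirect p C P l)
    {R : Subgroup G} (hR : R ≤ P) {S : Finset (Fin t)}
    {m : Subgroup G →₀ ℤ} (hm : ∀ Q ∈ m.support, Q ≤ R)
    (hm' : ∀ x ∈ R, (∀ u ∈ cycPart C l S, u * x = x * u) → massAt x m = 0) :
    altHom C l S m ∈ relOn (R ⊔ cycPart C l S) := by
  classical
  refine ⟨le_of_mem_support_altHom le_sup_right fun Q hQ => (hm Q hQ).trans le_sup_left, ?_⟩
  intro d hd
  have hN := h.normal_of_le (cycPart_le C l S)
  have hsum : m = m.sum Finsupp.single := m.sum_single.symm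
  by_cases hcent : ∀ i ∈ S, ∀ c ∈ torsionPart C (l i), c * d = d * c
  · obtain ⟨x, hx, c, hc, rfl⟩ := Subgroup.mem_sup_of_normal_right.1 hd
    have hle : cycPart C l S ≤ Subgroup.centralizer {x * c} := by
      rw [cycPart_le_iff]
      intro i hi u hu
      exact Subgroup.mem_centralizer_singleton_iff.2 (hcent i hi u hu)
    have hux : ∀ u ∈ cycPart C l S, u * x = x * u := by
      intro u hu
      have h1 := Subgroup.mem_centralizer_singleton_iff.1 (hle hu)
      have h2 := mul_comm_of_mem_cyclic h.cyclic (cycPart_le C l S hu) (cycPart_le C l S hc)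
      rw [← mul_assoc, mul_assoc x c u, ← h2, ← mul_assoc] at h1
      exact mul_right_cancel h1
    rw [hsum, Finsupp.sum, map_sum, map_sum,
      Finset.sum_congr rfl fun Q hQ => h.fixHom_altHom hR (hm Q hQ) hx hc hux (m Q),
      ← Finset.sum_mul, ← map_sum, ← Finsupp.sum, ← hsum, hm' x hx hux, zero_mul]
  · push Not at hcent
    obtain ⟨i, hi, c, hc, hcd⟩ := hcent
    rw [hsum, Finsupp.sum, map_sum, map_sum]
    exact Finset.sum_eq_zero fun Q hQ => h.fixHom_altHom_eq_zero ((hm Q hQ).trans hR) le_sup_right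
      hi (fun hall => hcd (hall c hc)) _

/-- Raising ak to the power p^r removes k, and a is a power of a^(p^r) because its order is prime to
p. -/
theorem mem_of_mul_mem (h : IsFaithfulSemidirect p C P l)
    {H : Subgroup G} {a k : G} (ha : a ∈ C) (hak : Commute a k) {r : ℕ}
    (hk : k ^ p ^ r = 1) (hH : a * k ∈ H) : a ∈ H ∧ k ∈ H := by
  have h1 : a ^ p ^ r ∈ H := by
    have := H.pow_mem hH (p ^ r)
    rwa [hak.mul_pow, hk, mul_one] at this
  have hord : orderOf a ∣ Nat.card C := by
    rw [← Subgroup.orderOf_mk a ha]; exact orderOf_dvd_natCard _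
  have h2 : a ∈ Subgroup.zpowers (a ^ p ^ r) := by
    rw [mem_zpowers_pow_iff]
    exact ((h.coprime_card_p.coprime_dvd_left hord).pow_right r).symm
  have h3 : a ∈ H := (Subgroup.zpowers_le.2 h1) h2
  exact ⟨h3, (Subgroup.mul_mem_cancel_left H h3).1 hH⟩

open Classical in
/-- For a relation of `D` and a central `p`-element `k` of `D`, the part of the relation
supported on `p`-subgroups has zero mass at `k`. -/
theorem massAt_filter_eq_zero (h : IsFaithfulSemidirect p C P l)
    {D : Subgroup G} {n : Subgroup G →₀ ℤ} (hn : n ∈ relOn D) {k : G}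
    (hkD : k ∈ D) (hk : ∀ y ∈ D, y * k = k * y) {r : ℕ} (hkr : k ^ p ^ r = 1) :
    massAt k (n.filter fun H => H ⊓ C = ⊥) = 0 := by
  have hNC := h.normal
  -- The relation is evaluated at ck, with c a generator of C_A. As k is central in D and H ∩ C is
  -- normal, ck ∈ H is stable under conjugation in D and means C_A ≤ H and k ∈ H.
  have hA : ∀ A : Finset (Fin t),
      (n.sum fun H a => (a : ℚ) *
        if cycPart C l A ≤ H ∧ k ∈ H then (1 : ℚ) / Nat.card H else 0) = 0 := by
    intro A
    by_cases hAD : cycPart C l A ≤ D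
    · have hcyc : IsCyclic (cycPart C l A) := by
        have := h.cyclic
        exact isCyclic_of_injective (Subgroup.inclusion (cycPart_le C l A))
          (Subgroup.inclusion_injective _)
      obtain ⟨c, hc⟩ := (Subgroup.isCyclic_iff_exists_zpowers_eq_top _).1 hcyc
      have hcA : c ∈ cycPart C l A := hc ▸ Subgroup.mem_zpowers c
      have hcC := cycPart_le C l A hcA
      have hcH : ∀ H : Subgroup G, cycPart C l A ≤ H ↔ c ∈ H := fun H => by
        rw [← hc, Subgroup.zpowers_le]
      have hmem : ∀ (H : Subgroup G) (a : G), a ∈ C → a ∈ D → (a * k ∈ H ↔ a ∈ H ∧ k ∈ H) :=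
        fun H a ha haD => ⟨h.mem_of_mul_mem ha (hk a haD) hkr, fun h1 => H.mul_mem h1.1 h1.2⟩
      have h1 := hn.2 (c * k) (D.mul_mem (hAD hcA) hkD)
      have hD := card_pos_rat D
      rw [← mul_left_inj' hD.ne', zero_mul]
      refine Eq.trans ?_ h1
      rw [fixHom_apply, Finsupp.sum_mul]
      refine Finsupp.sum_congr fun H hH => ?_
      rw [fixCount_of_conj_mem_iff, hmem H c hcC (hAD hcA), ← hcH]
      · split_ifs <;> ring
      · intro y hy
        have e : y⁻¹ * (c * k) * y = (y⁻¹ * c * y) * k := by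
          have e1 := hk y hy
          calc y⁻¹ * (c * k) * y = y⁻¹ * c * (k * y) := by group
            _ = (y⁻¹ * c * y) * k := by rw [← e1]; group
        have hcy : y⁻¹ * c * y ∈ C := by simpa using hNC.conj_mem c hcC y⁻¹
        rw [e, hmem H _ hcy (D.mul_mem (D.mul_mem (D.inv_mem hy) (hAD hcA)) hy),
          hmem H c hcC (hAD hcA)]
        refine and_congr_left fun _ => ?_
        have hHC := h.normal_of_le (inf_le_right : H ⊓ C ≤ C)
        constructor
        · intro h2
          have h3 := hHC.conj_mem _ (⟨h2, hcy⟩ : y⁻¹ * c * y ∈ H ⊓ C) y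
          have e2 : y * (y⁻¹ * c * y) * y⁻¹ = c := by group
          rw [e2] at h3
          exact h3.1
        · intro h2
          have h3 := hHC.conj_mem _ (⟨h2, hcC⟩ : c ∈ H ⊓ C) y⁻¹
          simpa using h3.1
    · refine Finset.sum_eq_zero fun H hH => ?_
      have : ¬ (cycPart C l A ≤ H ∧ k ∈ H) := fun h1 => hAD (h1.1.trans (hn.1 H hH))
      simp only [if_neg this, mul_zero]
  -- The sum runs over the subsets of {i : C_{l_i} ≤ H}, a set that is empty exactly when H avoids
  -- C.
  have hmob : ∀ H : Subgroup G, (∑ A : Finset (Fin t),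
      (-1 : ℚ) ^ A.card * if cycPart C l A ≤ H then 1 else 0) = if H ⊓ C = ⊥ then 1 else 0 := by
    intro H
    have h1 : ∀ A : Finset (Fin t), cycPart C l A ≤ H ↔
        A ∈ (Finset.univ.filter fun i => torsionPart C (l i) ≤ H).powerset := by
      intro A
      rw [cycPart_le_iff, Finset.mem_powerset]
      exact ⟨fun h1 i hi => by simpa using h1 i hi, fun h1 i hi => by simpa using h1 hi⟩
    simp only [h1, mul_ite, mul_one, mul_zero]
    rw [← Finset.sum_filter, Finset.filter_mem_eq_inter, Finset.univ_inter]
    have h2 := Finset.sum_powerset_neg_one_pow_card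
      (x := Finset.univ.filter fun i => torsionPart C (l i) ≤ H)
    have h3 : (Finset.univ.filter fun i => torsionPart C (l i) ≤ H) = ∅ ↔ H ⊓ C = ⊥ := by
      rw [Finset.filter_eq_empty_iff]
      constructor
      · intro h4
        by_contra h5
        obtain ⟨i, hi⟩ := h.exists_torsionPart_le h5
        exact h4 (Finset.mem_univ i) hi
      · intro h4 i _ hi
        refine h.torsionPart_ne_bot i (eq_bot_iff.2 ?_)
        rw [← h4]
        exact le_inf hi (torsionPart_le C _)
    simp only [h3] at h2
    exact_mod_cast h2
  have htot : massAt k (n.filter fun H => H ⊓ C = ⊥) =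
      ∑ A : Finset (Fin t), (-1 : ℚ) ^ A.card * n.sum fun H a => (a : ℚ) *
        if cycPart C l A ≤ H ∧ k ∈ H then (1 : ℚ) / Nat.card H else 0 := by
    rw [massAt_apply, Finsupp.sum_filter_index, Finsupp.support_filter, Finset.sum_filter]
    simp only [Finsupp.sum, Finset.mul_sum]
    rw [Finset.sum_comm]
    refine Finset.sum_congr rfl fun H _ => ?_
    have h1 : ∀ A : Finset (Fin t), (-1 : ℚ) ^ A.card * ((n H : ℚ) *
        if cycPart C l A ≤ H ∧ k ∈ H then (1 : ℚ) / Nat.card H else 0) =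
        ((-1 : ℚ) ^ A.card * if cycPart C l A ≤ H then 1 else 0) *
          (n H * if k ∈ H then (1 : ℚ) / Nat.card H else 0) := by
      intro A
      by_cases h2 : cycPart C l A ≤ H <;> by_cases h3 : k ∈ H <;> simp [h2, h3]
    rw [Finset.sum_congr rfl fun A _ => h1 A, ← Finset.sum_mul, hmob]
    split_ifs <;> simp
  rw [htot]
  exact Finset.sum_eq_zero fun A _ => by rw [hA A, mul_zero]

end IsFaithfulSemidirect

/-! ### Subgroups of index p -/

theorem exists_le_index_eq {P : Type*} [Group P] [Finite P] {p : ℕ} (hp : p.Prime)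
    (hP : IsPGroup p P) {Q : Subgroup P} (hQ : Q ≠ ⊤) : ∃ M : Subgroup P, Q ≤ M ∧ M.index = p := by
  have := Fact.mk hp
  obtain ⟨k, hk⟩ := hP.exists_card_eq
  obtain ⟨n, hn, hn'⟩ := (Nat.dvd_prime_pow hp).1 (hk ▸ Subgroup.card_subgroup_dvd_card Q)
  have hlt : n < k := by
    refine lt_of_le_of_ne hn fun e => hQ ?_
    exact Subgroup.eq_top_of_card_eq Q (by rw [hn', hk, e])
  obtain ⟨M, hM, hQM⟩ := Sylow.exists_subgroup_card_pow_prime_le p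
    (m := k - 1) (hk ▸ pow_dvd_pow p (Nat.sub_le k 1)) Q hn' (by omega)
  refine ⟨M, hQM, ?_⟩
  have h1 := M.card_mul_index
  rw [hM, hk] at h1
  have h2 : p ^ k = p ^ (k - 1) * p := by rw [← pow_succ]; congr 1; omega
  rw [h2] at h1
  exact Nat.eq_of_mul_eq_mul_left (pow_pos hp.pos _) h1

theorem relIndex_eq_of_not_le {P : Type*} [Group P] {p : ℕ} (hp : p.Prime)
    {M : Subgroup P} [M.Normal] (hM : M.index = p) {K : Subgroup P} (hK : ¬ K ≤ M) :
    M.relIndex K = p := by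
  have h1 := Subgroup.relIndex_dvd_index_of_normal M K
  rw [hM, Nat.dvd_prime hp] at h1
  exact h1.resolve_left fun h2 => hK (Subgroup.relIndex_eq_one.1 h2)

/-- Two normal subgroups of index `p` not containing a cyclic subgroup `K` meet `K` in the same
subgroup. -/
theorem mem_iff_mem_of_isCyclic {P : Type*} [Group P] {p : ℕ} (hp : p.Prime) {K : Subgroup P}
    (hK : IsCyclic K) {M M' : Subgroup P} [M.Normal] [M'.Normal] (hM : M.index = p)
    (hM' : M'.index = p) (hKM : ¬ K ≤ M) (hKM' : ¬ K ≤ M') {x : P} (hx : x ∈ K) :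
    x ∈ M ↔ x ∈ M' := by
  obtain ⟨k, hk⟩ := (Subgroup.isCyclic_iff_exists_zpowers_eq_top K).1 hK
  rw [← hk] at hx
  obtain ⟨a, rfl⟩ := hx
  -- For a generator k of K the criterion on the exponent does not depend on N; if p ∤ a, Bézout
  -- recovers k from k^p and k^a.
  have key : ∀ N : Subgroup P, N.Normal → N.index = p → ¬ K ≤ N → (k ^ a ∈ N ↔ (p : ℤ) ∣ a) := by
    intro N hN hNp hKN
    have hpow : k ^ p ∈ N := hNp ▸ N.pow_index_mem k
    constructor
    · intro ha
      by_contra hpa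
      obtain ⟨u, v, huv⟩ := (Nat.prime_iff_prime_int.1 hp).irreducible.coprime_iff_not_dvd.2 hpa
      apply hKN
      rw [← hk, Subgroup.zpowers_le]
      have h1 := N.mul_mem (N.zpow_mem hpow u) (N.zpow_mem ha v)
      have e : (k ^ p) ^ u * (k ^ a) ^ v = k := by
        rw [← zpow_natCast, ← zpow_mul, ← zpow_mul, ← zpow_add, mul_comm _ u, mul_comm _ v, huv,
          zpow_one]
      rwa [e] at h1
    · rintro ⟨b, rfl⟩
      rw [zpow_mul, zpow_natCast]
      exact N.zpow_mem hpow b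
  change k ^ a ∈ M ↔ k ^ a ∈ M'
  rw [key M inferInstance hM hKM, key M' inferInstance hM' hKM']

/-! ### The classes a(Q) modulo imprimitive relations -/

namespace IsFaithfulSemidirect

variable [Finite G] {p : ℕ} {C P : Subgroup G} {t : ℕ} {l : Fin t → ℕ}

/-- The class of `∑_A (-1)^{|A|} Q C_A` modulo imprimitive relations, for combinations of `Q`. -/
def altClass (C : Subgroup G) {t : ℕ} (l : Fin t → ℕ) :
    (Subgroup G →₀ ℤ) →+ Burnside G ⧸ imprimitive G :=
  (QuotientAddGroup.mk' _).comp (toBurnside.comp (altHom C l Finset.univ))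

/-- The class of `∑_A (-1)^{|A|} Q C_A` modulo imprimitive relations, for `Q ≤ P`. -/
def altClassOf (C P : Subgroup G) {t : ℕ} (l : Fin t → ℕ) (Q : Subgroup P) :
    Burnside G ⧸ imprimitive G :=
  altClass C l (Finsupp.single (Q.map P.subtype) 1)

theorem altClass_eq_zero_iff {m : Subgroup G →₀ ℤ} :
    altClass C l m = 0 ↔ toBurnside (altHom C l Finset.univ m) ∈ imprimitive G :=
  QuotientAddGroup.eq_zero_iff _

theorem normal_of_subgroup_P (h : IsFaithfulSemidirect p C P l) (M : Subgroup P) : M.Normal :=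
  ⟨fun m hm x => by
    have : x * m = m * x := Subtype.ext (h.commute_of_mem_P x.2 m.2)
    rwa [this, mul_inv_cancel_right]⟩

theorem thetaRel_eq (h : IsFaithfulSemidirect p C P l) (M M' : Subgroup P) :
    thetaRel C P M M' = toBurnside (altHom C l Finset.univ
      (Finsupp.single (M.map P.subtype) 1 - Finsupp.single (M'.map P.subtype) 1)) := by
  rw [thetaRel, h.sum_subgroup_moebius
    (fun V => cls (M.map P.subtype ⊔ V) - cls (M'.map P.subtype ⊔ V)), map_sub, map_sub,
    altHom_single, altHom_single, map_sum, map_sum, ← Finset.sum_sub_distrib, Finset.powerset_univ]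
  refine Finset.sum_congr rfl fun A _ => ?_
  rw [map_zsmul, map_zsmul, toBurnside_single, toBurnside_single, one_smul, one_smul, smul_sub]

theorem sup_C_ne_top (h : IsFaithfulSemidirect p C P l)
    {M : Subgroup P} (hM : M.index = p) : M.map P.subtype ⊔ C ≠ ⊤ := by
  intro htop
  have h1 := h.card_sup_of_le (Subgroup.map_subtype_le M) le_rfl
  have h2 : Nat.card (M.map P.subtype) = Nat.card M :=
    (Nat.card_congr (M.equivMapOfInjective _ P.subtype_injective).toEquiv).symm
  rw [htop, Subgroup.card_top, ← h.card_mul_card, h2, ← M.card_mul_index, hM, mul_comm] at h1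
  have h3 := Nat.eq_of_mul_eq_mul_right Nat.card_pos h1
  have h4 : Nat.card M * p = Nat.card M * 1 := by rw [h3, mul_one]
  exact h.prime.one_lt.ne' (Nat.eq_of_mul_eq_mul_left Nat.card_pos h4)

theorem sup_cycPart_ne_top (h : IsFaithfulSemidirect p C P l)
    (i : Fin t) : P ⊔ cycPart C l (Finset.univ.erase i) ≠ ⊤ := by
  intro htop
  refine h.not_torsionPart_le_sup le_rfl (Finset.notMem_erase i Finset.univ) ?_
  rw [htop]
  exact le_top

/-- Only x = 1 centralises C, so mass zero at 1 already gives a relation of MC, which is a proper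
subgroup. -/
theorem altClass_eq_zero_of_massAt_one (h : IsFaithfulSemidirect p C P l)
    {M : Subgroup P} (hM : M.index = p)
    {m : Subgroup G →₀ ℤ} (hm : ∀ Q ∈ m.support, Q ≤ M.map P.subtype) (hm' : massAt 1 m = 0) :
    altClass C l m = 0 := by
  rw [altClass_eq_zero_iff]
  have h1 := h.altHom_mem_relOn (S := Finset.univ) (Subgroup.map_subtype_le M) hm (by
    intro x hx hcent
    rw [h.cycPart_univ] at hcent
    rwa [h.eq_one_of_centralizes (Subgroup.map_subtype_le M hx) hcent])
  rw [h.cycPart_univ] at h1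
  exact toBurnside_mem_imprimitive_of_relOn (h.sup_C_ne_top hM) h1

theorem altHom_univ_mem_relOn_top (h : IsFaithfulSemidirect p C P l)
    {m : Subgroup G →₀ ℤ} (hm : ∀ Q ∈ m.support, Q ≤ P)
    (hm' : massAt 1 m = 0) : altHom C l Finset.univ m ∈ relOn (⊤ : Subgroup G) := by
  refine relOn_le_relOn_top _ (h.altHom_mem_relOn (S := Finset.univ) le_rfl hm ?_)
  intro x hx hcent
  rw [h.cycPart_univ] at hcent
  rwa [h.eq_one_of_centralizes hx hcent]

/-- Omitting the index i gives a relation Ψ induced from the proper subgroup P·C_{≠i}. The full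
alternating sum is Ψ minus its image under H ↦ H·C_{l_i}, which is inflated. -/
theorem altClass_eq_zero_of_massAt_Kj (h : IsFaithfulSemidirect p C P l)
    (i : Fin t) {m : Subgroup G →₀ ℤ}
    (hm : ∀ Q ∈ m.support, Q ≤ P) (hm' : ∀ x ∈ Kj C P l i, massAt (x : G) m = 0) :
    altClass C l m = 0 := by
  rw [altClass_eq_zero_iff]
  have h1 := h.altHom_mem_relOn (S := Finset.univ.erase i) le_rfl hm
    fun x hx hcent => hm' ⟨x, hx⟩ (mem_Kj_iff.2 hcent)
  rw [← Finset.insert_erase (Finset.mem_univ i), altHom_insert (Finset.notMem_erase i _), map_sub]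
  exact AddSubgroup.sub_mem _ (toBurnside_mem_imprimitive_of_relOn (h.sup_cycPart_ne_top i) h1)
    (h.toBurnside_supHom_mem_imprimitive i (relOn_le_relOn_top _ h1))

theorem mem_support_single_sub {A B : Subgroup G} {a b : ℤ} {Q : Subgroup G}
    (hQ : Q ∈ (Finsupp.single A a - Finsupp.single B b).support) : Q = A ∨ Q = B := by
  classical
  rcases Finset.mem_union.1 (Finsupp.support_sub hQ) with h1 | h1
  · exact Or.inl (Finset.mem_singleton.1 (Finsupp.support_single_subset h1))
  · exact Or.inr (Finset.mem_singleton.1 (Finsupp.support_single_subset h1))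

theorem altClass_single (C P : Subgroup G) (l : Fin t → ℕ) (Q : Subgroup P) (k : ℤ) :
    altClass C l (Finsupp.single (Q.map P.subtype) k) = k • altClassOf C P l Q := by
  rw [altClassOf, ← map_zsmul, Finsupp.smul_single, smul_eq_mul, mul_one]

theorem card_map_subtype (Q : Subgroup P) : Nat.card (Q.map P.subtype) = Nat.card Q :=
  (Nat.card_congr (Q.equivMapOfInjective _ P.subtype_injective).toEquiv).symm

theorem coe_mem_map_subtype {Q : Subgroup P} {x : P} : (x : G) ∈ Q.map P.subtype ↔ x ∈ Q :=
  Subgroup.mem_map_iff_mem P.subtype_injective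

theorem altClassOf_of_le (h : IsFaithfulSemidirect p C P l)
    {M Q : Subgroup P} (hM : M.index = p) (hQ : Q ≤ M) :
    altClassOf C P l Q = (Q.relIndex M : ℤ) • altClassOf C P l M := by
  rw [← sub_eq_zero, ← altClass_single, altClassOf, ← map_sub]
  refine h.altClass_eq_zero_of_massAt_one hM (fun R hR => ?_) ?_
  · rcases mem_support_single_sub hR with rfl | rfl
    · exact Subgroup.map_mono hQ
    · exact le_rfl
  · have h1 := Subgroup.relIndex_mul_relIndex ⊥ Q M bot_le hQ
    simp only [Subgroup.relIndex_bot_left] at h1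
    rw [map_sub, massAt_single, massAt_single, if_pos (one_mem _), if_pos (one_mem _),
      card_map_subtype, card_map_subtype, ← h1]
    have h2 : (Nat.card Q : ℚ) ≠ 0 := (card_pos_rat Q).ne'
    have h3 : (Q.relIndex M : ℚ) ≠ 0 := by
      intro h0
      rw [Nat.cast_eq_zero] at h0
      rw [h0, mul_zero] at h1
      exact Nat.card_pos.ne h1
    push_cast
    field_simp
    ring

theorem altClassOf_of_Kj_le (h : IsFaithfulSemidirect p C P l)
    {M : Subgroup P} (hM : M.index = p) {i : Fin t}
    (hi : Kj C P l i ≤ M) : altClassOf C P l M = (p : ℤ) • altClassOf C P l ⊤ := by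
  rw [← sub_eq_zero, ← altClass_single, altClassOf, ← map_sub]
  refine h.altClass_eq_zero_of_massAt_Kj i (fun R hR => ?_) fun x hx => ?_
  · rcases mem_support_single_sub hR with rfl | rfl <;> exact Subgroup.map_subtype_le _
  · rw [map_sub, massAt_single, massAt_single, if_pos (coe_mem_map_subtype.2 (hi hx)),
      if_pos (coe_mem_map_subtype.2 (Subgroup.mem_top x)), card_map_subtype, card_map_subtype,
      Subgroup.card_top, ← M.card_mul_index, hM]
    have h2 : (Nat.card M : ℚ) ≠ 0 := (card_pos_rat M).ne'
    have h3 : (p : ℚ) ≠ 0 := by exact_mod_cast h.prime.ne_zero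
    push_cast
    field_simp
    ring

/-- M and M' have the same order and meet the cyclic group K_i in the same subgroup, so their masses
agree at every element of K_i. -/
theorem altClassOf_of_not_Kj_le (h : IsFaithfulSemidirect p C P l)
    {M M' : Subgroup P} (hM : M.index = p) (hM' : M'.index = p)
    {i : Fin t} (hi : ¬ Kj C P l i ≤ M) (hi' : ¬ Kj C P l i ≤ M') :
    altClassOf C P l M = altClassOf C P l M' := by
  have hN := h.normal_of_subgroup_P M
  have hN' := h.normal_of_subgroup_P M'
  rw [← sub_eq_zero, altClassOf, altClassOf, ← map_sub]
  refine h.altClass_eq_zero_of_massAt_Kj i (fun R hR => ?_) fun x hx => ?_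
  · rcases mem_support_single_sub hR with rfl | rfl <;> exact Subgroup.map_subtype_le _
  · have hcard : Nat.card M = Nat.card M' := by
      have h1 := M.card_mul_index
      rw [hM, ← M'.card_mul_index, hM'] at h1
      exact Nat.eq_of_mul_eq_mul_right h.prime.pos h1
    have hiff := mem_iff_mem_of_isCyclic h.prime (h.isCyclic_Kj i) hM hM' hi hi' hx
    rw [map_sub, massAt_single, massAt_single, card_map_subtype, card_map_subtype, hcard]
    by_cases hxM : x ∈ M
    · rw [if_pos (coe_mem_map_subtype.2 hxM), if_pos (coe_mem_map_subtype.2 (hiff.1 hxM)), sub_self]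
    · rw [if_neg (mt coe_mem_map_subtype.1 hxM),
        if_neg (mt coe_mem_map_subtype.1 (mt hiff.2 hxM)), sub_self]

/-- If M ≠ M', both sides equal the class attached to M ∩ M', which has index p in each. -/
theorem prime_smul_altClassOf (h : IsFaithfulSemidirect p C P l)
    {M M' : Subgroup P} (hM : M.index = p) (hM' : M'.index = p) :
    (p : ℤ) • altClassOf C P l M = (p : ℤ) • altClassOf C P l M' := by
  have hN := h.normal_of_subgroup_P M
  have hN' := h.normal_of_subgroup_P M'
  have key : ∀ A B : Subgroup P, A.index = p → B.index = p → A ≤ B → A = B := by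
    intro A B hA hB hle
    have h1 := Subgroup.relIndex_mul_index hle
    rw [hA, hB] at h1
    have h2 := Nat.eq_of_mul_eq_mul_right h.prime.pos (h1.trans (one_mul p).symm)
    exact le_antisymm hle (Subgroup.relIndex_eq_one.1 h2)
  by_cases hMM : M = M'
  · rw [hMM]
  · have h1 := h.altClassOf_of_le hM (inf_le_left : M ⊓ M' ≤ M)
    have h2 := h.altClassOf_of_le hM' (inf_le_right : M ⊓ M' ≤ M')
    rw [inf_comm, Subgroup.inf_relIndex_right,
      relIndex_eq_of_not_le h.prime hM' fun hle => hMM (key M M' hM hM' hle)] at h1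
    rw [Subgroup.inf_relIndex_right,
      relIndex_eq_of_not_le h.prime hM fun hle => hMM (key M' M hM' hM hle).symm, inf_comm] at h2
    rw [← h1, ← h2]

theorem toBurnside_altHom_conj (h : IsFaithfulSemidirect p C P l)
    (S : Finset (Fin t)) (H : Subgroup G) (g : G) (k : ℤ) :
    toBurnside (altHom C l S (Finsupp.single (H.map (MulAut.conj g).toMonoidHom) k)) =
      toBurnside (altHom C l S (Finsupp.single H k)) := by
  rw [altHom_single, altHom_single, map_sum, map_sum]
  refine Finset.sum_congr rfl fun A _ => ?_
  rw [map_zsmul, map_zsmul, toBurnside_single, toBurnside_single]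
  congr 2
  have hN := h.normal_of_le (cycPart_le C l A)
  have hU : (cycPart C l A).map (MulAut.conj g).toMonoidHom = cycPart C l A :=
    Subgroup.Normal.map_conj_eq _ g
  rw [cls, cls]
  congr 1
  refine (Quotient.sound (s := conjSetoid G) ⟨g, ?_⟩).symm
  rw [Subgroup.map_sup, hU]

/-- Modulo imprimitive relations every relation is a degree zero combination of alternating
sums attached to subgroups of `P`. -/
theorem exists_eq_sum_altClassOf (h : IsFaithfulSemidirect p C P l)
    {Θ : Burnside G} (hΘ : Θ ∈ relations G) :
    ∃ m : Subgroup P →₀ ℤ, (m.sum fun Q k => k * (Q.index : ℤ)) = 0 ∧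
      (Θ : Burnside G ⧸ imprimitive G) = m.sum fun Q k => k • altClassOf C P l Q := by
  classical
  obtain ⟨n, rfl⟩ := toBurnside_surjective Θ
  rw [toBurnside_mem_relations, ← mem_relOn_top] at hΘ
  -- For H meeting C the choice of g is immaterial: such H are filtered out and their alternating
  -- sums vanish.
  have hconj : ∀ H : Subgroup G, ∃ g : G, H ⊓ C = ⊥ → H.map (MulAut.conj g).toMonoidHom ≤ P := by
    intro H
    by_cases hH : H ⊓ C = ⊥
    · obtain ⟨g, hg⟩ := h.exists_conj_le (h.isPGroup_of_inf hH)
      exact ⟨g, fun _ => hg⟩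
    · exact ⟨1, fun h1 => absurd h1 hH⟩
  choose γ hγ using hconj
  let σ : Subgroup G → Subgroup P := fun H =>
    (H.map (MulAut.conj (γ H)).toMonoidHom).subgroupOf P
  have hσ : ∀ H, H ⊓ C = ⊥ → (σ H).map P.subtype = H.map (MulAut.conj (γ H)).toMonoidHom := by
    intro H hH
    simpa [σ] using hγ H hH
  have hcard : ∀ H, H ⊓ C = ⊥ → Nat.card (σ H) = Nat.card H := by
    intro H hH
    rw [← card_map_subtype, hσ H hH]
    exact (Nat.card_congr (H.equivMapOfInjective _ (MulAut.conj (γ H)).injective).toEquiv).symm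
  set n' := n.filter fun H => H ⊓ C = ⊥ with hn'
  have hsupp : ∀ H ∈ n'.support, H ⊓ C = ⊥ := by
    intro H hH
    rw [hn', Finsupp.support_filter] at hH
    exact (Finset.mem_filter.1 hH).2
  refine ⟨n'.mapDomain σ, ?_, ?_⟩
  · rw [Finsupp.sum_mapDomain_index (by simp) (by intros; ring)]
    -- Mass zero at the identity says ∑ n_H/|H| = 0 over the H avoiding C; multiplying by |P| turns
    -- this into the sum of indices.
    have h1 := h.massAt_filter_eq_zero hΘ (k := 1) (Subgroup.mem_top 1) (by simp) (r := 0) (by simp)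
    rw [← hn', massAt_apply] at h1
    have h2 : ((n'.sum fun H k => k * ((σ H).index : ℤ) : ℤ) : ℚ) =
        (n'.sum fun H k => (k : ℚ) * if (1 : G) ∈ H then (1 : ℚ) / Nat.card H else 0) *
          Nat.card P := by
      rw [Finsupp.sum, Finsupp.sum_mul, Int.cast_sum]
      refine Finset.sum_congr rfl fun H hH => ?_
      have h3 := (σ H).card_mul_index
      rw [hcard H (hsupp H hH)] at h3
      have h4 := (card_pos_rat H).ne'
      simp only [if_pos H.one_mem, ← h3]
      push_cast
      field_simp
    rw [h1, zero_mul] at h2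
    exact_mod_cast h2
  · rw [Finsupp.sum_mapDomain_index (by simp) (by intros; exact add_zsmul _ _ _)]
    have h1 := h.toBurnside_sub_altHom_mem Finset.univ hΘ
    rw [map_sub] at h1
    have h2 : (toBurnside n : Burnside G ⧸ imprimitive G) = altClass C l n :=
      (QuotientAddGroup.eq_iff_sub_mem).2 h1
    have h3 : altClass C l n = altClass C l n' := by
      rw [← sub_eq_zero, ← map_sub]
      have h4 : n - n' = n.filter fun H => ¬ H ⊓ C = ⊥ := by
        rw [sub_eq_iff_eq_add, add_comm, hn', Finsupp.filter_add_filter_not]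
      rw [h4, ← (n.filter fun H => ¬ H ⊓ C = ⊥).sum_single, Finsupp.sum, map_sum]
      refine Finset.sum_eq_zero fun H hH => ?_
      rw [Finsupp.support_filter] at hH
      rw [altClass_eq_zero_iff, h.altHom_univ_single_eq_zero (Finset.mem_filter.1 hH).2, map_zero]
      exact AddSubgroup.zero_mem _
    rw [h2, h3]
    conv_lhs => rw [← n'.sum_single, Finsupp.sum, map_sum]
    refine Finset.sum_congr rfl fun H hH => ?_
    change _ = n' H • altClassOf C P l (σ H)
    rw [← altClass_single, hσ H (hsupp H hH)]
    simp only [altClass, AddMonoidHom.comp_apply]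
    rw [h.toBurnside_altHom_conj]

end IsFaithfulSemidirect

theorem sum_zsmul_right {ι A : Type*} [AddCommGroup A] (s : Finset ι) (f : ι → ℤ) (a : A) :
    (∑ i ∈ s, f i) • a = ∑ i ∈ s, f i • a :=
  map_sum (zmultiplesHom A a) f s

/-! ### Signatures -/

/-- The index `p` subgroups of `P` contain either all or none of the `K_j`, and both cases
occur. -/
structure SignatureDichotomy (p : ℕ) (C P : Subgroup G) {t : ℕ} (l : Fin t → ℕ) : Prop where
  all_or_none : ∀ M : Subgroup P, M.index = p →
    (∀ j, Kj C P l j ≤ M) ∨ ∀ j, ¬ Kj C P l j ≤ M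
  exists_all : ∃ M : Subgroup P, M.index = p ∧ ∀ j, Kj C P l j ≤ M
  exists_none : ∃ M : Subgroup P, M.index = p ∧ ∀ j, ¬ Kj C P l j ≤ M

theorem signature_eq_one_iff {C P : Subgroup G} {t : ℕ} {l : Fin t → ℕ} {M : Subgroup P} :
    signature C P l M = (fun _ => 1) ↔ ∀ j, Kj C P l j ≤ M := by
  simp only [signature, funext_iff]
  refine forall_congr' fun j => ?_
  split_ifs with hj <;> simp [hj]

theorem signature_eq_zero_iff {C P : Subgroup G} {t : ℕ} {l : Fin t → ℕ} {M : Subgroup P} :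
    signature C P l M = (fun _ => 0) ↔ ∀ j, ¬ Kj C P l j ≤ M := by
  simp only [signature, funext_iff]
  refine forall_congr' fun j => ?_
  split_ifs with hj <;> simp [hj]

theorem image_signature_eq_iff {p : ℕ} {C P : Subgroup G} {t : ℕ} {l : Fin t → ℕ} :
    signature C P l '' {M : Subgroup P | M.index = p} = {fun _ => 1, fun _ => 0} ↔
      SignatureDichotomy p C P l := by
  constructor
  · intro heq
    refine ⟨fun M hM => ?_, ?_, ?_⟩
    · have h1 : signature C P l M ∈ ({fun _ => 1, fun _ => 0} : Set (Fin t → ZMod 2)) :=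
        heq ▸ Set.mem_image_of_mem _ hM
      rcases h1 with h1 | h1
      · exact Or.inl (signature_eq_one_iff.1 h1)
      · exact Or.inr (signature_eq_zero_iff.1 h1)
    · have h1 : (fun _ => 1) ∈ signature C P l '' {M : Subgroup P | M.index = p} := by
        rw [heq]; exact Set.mem_insert _ _
      obtain ⟨M, hM, h2⟩ := h1
      exact ⟨M, hM, signature_eq_one_iff.1 h2⟩
    · have h1 : (fun _ => 0) ∈ signature C P l '' {M : Subgroup P | M.index = p} := by
        rw [heq]; exact Set.mem_insert_of_mem _ rfl
      obtain ⟨M, hM, h2⟩ := h1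
      exact ⟨M, hM, signature_eq_zero_iff.1 h2⟩
  · rintro ⟨h1, ⟨M, hM, h2⟩, ⟨M', hM', h3⟩⟩
    ext s
    constructor
    · rintro ⟨N, hN, rfl⟩
      rcases h1 N hN with h4 | h4
      · exact Or.inl (signature_eq_one_iff.2 h4)
      · exact Or.inr (signature_eq_zero_iff.2 h4)
    · rintro (rfl | rfl)
      · exact ⟨M, hM, signature_eq_one_iff.2 h2⟩
      · exact ⟨M', hM', signature_eq_zero_iff.2 h3⟩

/-! ### The Frattini subgroup of a p-group -/

section Frattini

variable {P : Type u} [Group P] [Finite P] {p : ℕ}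

theorem isCoatom_of_index_eq (hp : p.Prime) {M : Subgroup P} (hM : M.index = p) : IsCoatom M := by
  refine ⟨fun h => ?_, fun N hN => ?_⟩
  · rw [h, Subgroup.index_top] at hM
    exact hp.one_lt.ne hM
  · have h1 := Subgroup.relIndex_mul_index hN.le
    rw [hM] at h1
    rcases (Nat.dvd_prime hp).1 (Dvd.intro_left _ h1) with h2 | h2
    · exact Subgroup.index_eq_one.1 h2
    · rw [h2] at h1
      have h3 := Nat.eq_of_mul_eq_mul_right hp.pos (h1.trans (one_mul p).symm)
      exact absurd (Subgroup.relIndex_eq_one.1 h3) hN.not_ge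

theorem index_eq_of_isCoatom (hp : p.Prime) (hP : IsPGroup p P) {M : Subgroup P}
    (hM : IsCoatom M) : M.index = p := by
  obtain ⟨N, hMN, hN⟩ := exists_le_index_eq hp hP hM.1
  rcases hMN.eq_or_lt with rfl | hlt
  · exact hN
  · rw [hM.2 N hlt, Subgroup.index_top] at hN
    exact absurd hN hp.one_lt.ne

theorem le_frattini_iff (hp : p.Prime) (hP : IsPGroup p P) {K : Subgroup P} :
    K ≤ frattini P ↔ ∀ M : Subgroup P, M.index = p → K ≤ M := by
  constructor
  · exact fun hK M hM => hK.trans (frattini_le_coatom (isCoatom_of_index_eq hp hM))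
  · intro hK
    rw [frattini, Order.radical]
    exact le_iInf₂ fun M hM => hK M (index_eq_of_isCoatom hp hP hM)

/-- A subgroup maximal among those above N avoiding x is maximal in P. Any larger L contains x, and
for y ∉ M one has x = m·y^a with p ∤ a, because y^p ∈ Φ(P) ≤ M; hence y ∈ L. -/
theorem exists_index_eq_notMem (hp : p.Prime) (hP : IsPGroup p P)
    (hcomm : ∀ x y : P, x * y = y * x) {N : Subgroup P} (hN : frattini P ≤ N) {x : P}
    (hx : x ∉ N) : ∃ M : Subgroup P, N ≤ M ∧ M.index = p ∧ x ∉ M := by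
  have hnormal : ∀ M : Subgroup P, M.Normal := fun M =>
    ⟨fun m hm x => by rwa [hcomm x m, mul_inv_cancel_right]⟩
  have hpow : ∀ y : P, y ^ p ∈ frattini P := by
    intro y
    rw [← Subgroup.zpowers_le, le_frattini_iff hp hP]
    intro M hM
    have := hnormal M
    rw [Subgroup.zpowers_le, ← hM]
    exact M.pow_index_mem y
  obtain ⟨M, hNM, hM⟩ := Set.Finite.exists_le_maximal
    (Set.toFinite {M : Subgroup P | N ≤ M ∧ x ∉ M}) (show N ∈ {M | N ≤ M ∧ x ∉ M} from ⟨le_rfl, hx⟩)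
  refine ⟨M, hNM, index_eq_of_isCoatom hp hP ⟨?_, fun L hL => ?_⟩, hM.1.2⟩
  · rintro rfl
    exact hM.1.2 (Subgroup.mem_top x)
  have key : ∀ y ∉ M, x ∈ M ⊔ Subgroup.zpowers y := by
    intro y hy
    by_contra hxy
    have h1 := hM.2 (⟨hNM.trans le_sup_left, hxy⟩ : _ ∈ {M : Subgroup P | N ≤ M ∧ x ∉ M})
      le_sup_left
    exact hy (h1 (Subgroup.mem_sup_right (Subgroup.mem_zpowers y)))
  have hxL : x ∈ L := by
    obtain ⟨y, hyL, hyM⟩ := SetLike.exists_of_lt hL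
    exact sup_le hL.le (Subgroup.zpowers_le.2 hyL) (key y hyM)
  rw [eq_top_iff]
  intro y _
  by_cases hyM : y ∈ M
  · exact hL.le hyM
  have := hnormal M
  obtain ⟨m, hm, _, ⟨a, rfl⟩, e⟩ := Subgroup.mem_sup_of_normal_left.1 (key y hyM)
  dsimp only at e
  have hyp : y ^ p ∈ M := hNM (hN (hpow y))
  have hpa : ¬ (p : ℤ) ∣ a := by
    rintro ⟨b, rfl⟩
    apply hM.1.2
    rw [← e, zpow_mul, zpow_natCast]
    exact M.mul_mem hm (M.zpow_mem hyp b)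
  obtain ⟨u, v, huv⟩ := (Nat.prime_iff_prime_int.1 hp).irreducible.coprime_iff_not_dvd.2 hpa
  have hya : y ^ a ∈ L := by
    rw [← Subgroup.mul_mem_cancel_left L (hL.le hm), e]
    exact hxL
  have h1 := L.mul_mem (L.zpow_mem (hL.le hyp) u) (L.zpow_mem hya v)
  have e' : (y ^ p) ^ u * (y ^ a) ^ v = y := by
    rw [← zpow_natCast, ← zpow_mul, ← zpow_mul, ← zpow_add, mul_comm _ u, mul_comm _ v, huv,
      zpow_one]
  rwa [e'] at h1

theorem frattiniImage_eq_iff {H K : Subgroup P} :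
    frattiniImage H = frattiniImage K ↔ H ⊔ frattini P = K ⊔ frattini P := by
  have key : ∀ L : Subgroup P,
      (frattiniImage L).comap (QuotientGroup.mk' (frattini P)) = L ⊔ frattini P := by
    intro L
    rw [frattiniImage, Subgroup.comap_map_eq, QuotientGroup.ker_mk']
  rw [← key, ← key]
  exact (Subgroup.comap_injective (QuotientGroup.mk'_surjective _)).eq_iff.symm

theorem frattiniImage_eq_bot_iff {H : Subgroup P} :
    frattiniImage H = ⊥ ↔ H ≤ frattini P := by
  rw [frattiniImage, Subgroup.map_eq_bot_iff, QuotientGroup.ker_mk']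

end Frattini

/-! ### The Frattini criterion and the upper bound for Prim(G) -/

namespace IsFaithfulSemidirect

variable [Finite G] {p : ℕ} {C P : Subgroup G} {t : ℕ} {l : Fin t → ℕ}

theorem not_forall_Kj_eq_top (h : IsFaithfulSemidirect p C P l)
    (ht : 1 < t) (hP : P ≠ ⊥) : ¬ ∀ j, Kj C P l j = ⊤ := by
  intro htop
  have h1 := h.Kj_inf_Kj (i := ⟨0, by omega⟩) (j := ⟨1, ht⟩) (by simp)
  rw [htop, htop, inf_idem] at h1
  apply hP
  rw [Subgroup.eq_bot_iff_forall]
  intro x hx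
  have h2 : (⟨x, hx⟩ : P) ∈ (⊤ : Subgroup P) := Subgroup.mem_top _
  rw [h1, Subgroup.mem_bot] at h2
  exact congrArg Subtype.val h2

theorem frattiniImage_iff_signatureDichotomy (h : IsFaithfulSemidirect p C P l) (ht : 1 < t) :
    ((∀ i j, frattiniImage (Kj C P l i) = frattiniImage (Kj C P l j)) ∧
      ∀ j, frattiniImage (Kj C P l j) ≠ ⊥) ↔ SignatureDichotomy p C P l := by
  simp only [frattiniImage_eq_iff, Ne, frattiniImage_eq_bot_iff]
  have hΦ : ∀ M : Subgroup P, M.index = p → frattini P ≤ M := fun M hM =>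
    frattini_le_coatom (isCoatom_of_index_eq h.prime hM)
  constructor
  · rintro ⟨heq, hne⟩
    have key : ∀ M : Subgroup P, M.index = p → ∀ i j, Kj C P l i ≤ M → Kj C P l j ≤ M := by
      intro M hM i j hi
      have h1 : Kj C P l j ⊔ frattini P ≤ M := heq i j ▸ sup_le hi (hΦ M hM)
      exact le_sup_left.trans h1
    refine ⟨fun M hM => ?_, ?_, ?_⟩
    · by_cases h1 : ∃ i, Kj C P l i ≤ M
      · obtain ⟨i, hi⟩ := h1
        exact Or.inl fun j => key M hM i j hi
      · exact Or.inr (not_exists.1 h1)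
    -- If the first of the K_j were P, the second would equal their trivial intersection and have
    -- trivial image.
    · have h1 : Kj C P l ⟨0, by omega⟩ ≠ ⊤ := by
        intro htop
        have h2 := h.Kj_inf_Kj (i := ⟨0, by omega⟩) (j := ⟨1, ht⟩) (by simp)
        rw [htop, top_inf_eq] at h2
        exact hne ⟨1, ht⟩ (h2 ▸ bot_le)
      obtain ⟨M, hKM, hM⟩ := exists_le_index_eq h.prime h.isPGroup h1
      exact ⟨M, hM, fun j => key M hM _ j hKM⟩
    · have h1 := hne ⟨0, by omega⟩
      rw [le_frattini_iff h.prime h.isPGroup] at h1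
      push Not at h1
      obtain ⟨M, hM, hKM⟩ := h1
      exact ⟨M, hM, fun j hj => hKM (key M hM j _ hj)⟩
  · rintro ⟨hdich, -, ⟨M₀, hM₀, hnone⟩⟩
    refine ⟨?_, fun j hj => hnone j (hj.trans (hΦ M₀ hM₀))⟩
    have key : ∀ i j, Kj C P l i ≤ Kj C P l j ⊔ frattini P := by
      intro i j x hx
      by_contra hxN
      obtain ⟨M, hNM, hM, hxM⟩ := exists_index_eq_notMem h.prime h.isPGroup
        (fun x y => Subtype.ext (h.commute_of_mem_P x.2 y.2)) le_sup_right hxN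
      rcases hdich M hM with h1 | h1
      · exact hxM (h1 i hx)
      · exact h1 j (le_sup_left.trans hNM)
    exact fun i j => le_antisymm (sup_le (key i j) le_sup_right) (sup_le (key j i) le_sup_right)

/-- When M contains no K_j, an N of mixed signature links it to p·a(P): a K_j outside N compares M
with N, a K_i inside N compares N with P. -/
theorem altClassOf_eq_of_not_dichotomy (h : IsFaithfulSemidirect p C P l)
    (ht : 1 < t) (hc : ¬ SignatureDichotomy p C P l)
    {M : Subgroup P} (hM : M.index = p) :
    altClassOf C P l M = (p : ℤ) • altClassOf C P l ⊤ := by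
  by_cases h1 : ∃ j, Kj C P l j ≤ M
  · obtain ⟨j, hj⟩ := h1
    exact h.altClassOf_of_Kj_le hM hj
  rw [not_exists] at h1
  by_cases h2 : ∃ N : Subgroup P, N.index = p ∧ (∃ i, Kj C P l i ≤ N) ∧ ∃ j, ¬ Kj C P l j ≤ N
  · obtain ⟨N, hN, ⟨i, hi⟩, ⟨j, hj⟩⟩ := h2
    rw [h.altClassOf_of_not_Kj_le hM hN (h1 j) hj, h.altClassOf_of_Kj_le hN hi]
  have hdich : ∀ N : Subgroup P, N.index = p →
      (∀ j, Kj C P l j ≤ N) ∨ ∀ j, ¬ Kj C P l j ≤ N := by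
    intro N hN
    by_cases h3 : ∃ i, Kj C P l i ≤ N
    · refine Or.inl fun j => ?_
      by_contra hj
      exact h2 ⟨N, hN, h3, j, hj⟩
    · exact Or.inr (not_exists.1 h3)
  -- With no mixed signature and none equal to (1,…,1), no K_j lies in a subgroup of index p. Then
  -- all K_j equal P, against their trivial intersection.
  exfalso
  refine h.not_forall_Kj_eq_top ht ?_ fun j => ?_
  · rintro rfl
    have h3 := M.index_dvd_card
    rw [hM, Subgroup.card_bot, Nat.dvd_one] at h3
    exact h.prime.ne_one h3
  · by_contra hj
    obtain ⟨N, hKN, hN⟩ := exists_le_index_eq h.prime h.isPGroup hj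
    refine hc ⟨hdich, ⟨N, hN, ?_⟩, ⟨M, hM, h1⟩⟩
    exact (hdich N hN).resolve_right fun h3 => h3 j hKN

theorem relations_le_imprimitive (h : IsFaithfulSemidirect p C P l)
    (ht : 1 < t) (hc : ¬ SignatureDichotomy p C P l) :
    relations G ≤ imprimitive G := by
  intro Θ hΘ
  obtain ⟨m, hm, hΘm⟩ := h.exists_eq_sum_altClassOf hΘ
  have hQ : ∀ Q : Subgroup P, altClassOf C P l Q = (Q.index : ℤ) • altClassOf C P l ⊤ := by
    intro Q
    by_cases hQ : Q = ⊤
    · rw [hQ, Subgroup.index_top, Nat.cast_one, one_zsmul]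
    obtain ⟨M, hQM, hM⟩ := exists_le_index_eq h.prime h.isPGroup hQ
    rw [h.altClassOf_of_le hM hQM, h.altClassOf_eq_of_not_dichotomy ht hc hM, ← mul_zsmul',
      ← Subgroup.relIndex_mul_index hQM, hM, Nat.cast_mul, mul_comm]
  rw [← QuotientAddGroup.eq_zero_iff, hΘm]
  have h1 : (m.sum fun Q k => k • altClassOf C P l Q) =
      (m.sum fun Q k => k * (Q.index : ℤ)) • altClassOf C P l ⊤ := by
    rw [Finsupp.sum, Finsupp.sum, sum_zsmul_right]
    refine Finset.sum_congr rfl fun Q _ => ?_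
    rw [hQ, mul_zsmul]
  rw [h1, hm, zero_zsmul]

theorem coe_thetaRel (h : IsFaithfulSemidirect p C P l) (M M' : Subgroup P) :
    (thetaRel C P M M' : Burnside G ⧸ imprimitive G) =
      altClassOf C P l M - altClassOf C P l M' := by
  rw [h.thetaRel_eq, altClassOf, altClassOf, ← map_sub]
  rfl

theorem thetaRel_mem_relations (h : IsFaithfulSemidirect p C P l)
    {M M' : Subgroup P} (hM : M.index = p) (hM' : M'.index = p) :
    thetaRel C P M M' ∈ relations G := by
  rw [h.thetaRel_eq, toBurnside_mem_relations, ← mem_relOn_top]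
  refine h.altHom_univ_mem_relOn_top (fun R hR => ?_) ?_
  · rcases mem_support_single_sub hR with rfl | rfl <;> exact Subgroup.map_subtype_le _
  · have hcard : Nat.card M = Nat.card M' := by
      have h1 := M.card_mul_index
      rw [hM, ← M'.card_mul_index, hM'] at h1
      exact Nat.eq_of_mul_eq_mul_right h.prime.pos h1
    rw [map_sub, massAt_single, massAt_single, if_pos (one_mem _), if_pos (one_mem _),
      card_map_subtype, card_map_subtype, hcard, sub_self]

theorem prime_smul_thetaRel_mem (h : IsFaithfulSemidirect p C P l)
    {M M' : Subgroup P} (hM : M.index = p) (hM' : M'.index = p) :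
    (p : ℤ) • thetaRel C P M M' ∈ imprimitive G := by
  rw [← QuotientAddGroup.eq_zero_iff, QuotientAddGroup.mk_zsmul, h.coe_thetaRel, zsmul_sub,
    h.prime_smul_altClassOf hM hM', sub_self]

/-- Modulo multiples of y = a(M) - a(M') every a(Q) is [P:Q] a(P), and a relation has total index
zero, so only a multiple of y survives. -/
theorem exists_sub_zsmul_thetaRel_mem (h : IsFaithfulSemidirect p C P l) (ht : 1 < t)
    (hdich : ∀ M : Subgroup P, M.index = p → (∀ j, Kj C P l j ≤ M) ∨ ∀ j, ¬ Kj C P l j ≤ M)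
    {M M' : Subgroup P} (hM : M.index = p) (hM' : M'.index = p) (hall : ∀ j, Kj C P l j ≤ M)
    (hnone : ∀ j, ¬ Kj C P l j ≤ M') {Θ : Burnside G} (hΘ : Θ ∈ relations G) :
    ∃ k : ℤ, Θ - k • thetaRel C P M M' ∈ imprimitive G := by
  obtain ⟨m, hm, hΘm⟩ := h.exists_eq_sum_altClassOf hΘ
  set y := altClassOf C P l M - altClassOf C P l M' with hy
  have i₀ : Fin t := ⟨0, by omega⟩
  have hyM' : altClassOf C P l M' = (p : ℤ) • altClassOf C P l ⊤ - y := by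
    rw [hy, h.altClassOf_of_Kj_le hM (hall i₀), sub_sub_cancel]
  have hmax : ∀ N : Subgroup P, N.index = p →
      ∃ s : ℤ, altClassOf C P l N = (p : ℤ) • altClassOf C P l ⊤ + s • y := by
    intro N hN
    rcases hdich N hN with h1 | h1
    · exact ⟨0, by rw [h.altClassOf_of_Kj_le hN (h1 i₀), zero_zsmul, add_zero]⟩
    · refine ⟨-1, ?_⟩
      rw [h.altClassOf_of_not_Kj_le hN hM' (h1 i₀) (hnone i₀), hyM', neg_one_zsmul,
        sub_eq_add_neg]
  have hQ : ∀ Q : Subgroup P,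
      ∃ s : ℤ, altClassOf C P l Q = (Q.index : ℤ) • altClassOf C P l ⊤ + s • y := by
    intro Q
    by_cases hQ : Q = ⊤
    · exact ⟨0, by rw [hQ, Subgroup.index_top, Nat.cast_one, one_zsmul, zero_zsmul, add_zero]⟩
    obtain ⟨N, hQN, hN⟩ := exists_le_index_eq h.prime h.isPGroup hQ
    obtain ⟨s, hs⟩ := hmax N hN
    refine ⟨Q.relIndex N * s, ?_⟩
    rw [h.altClassOf_of_le hN hQN, hs, zsmul_add, ← mul_zsmul, ← mul_zsmul,
      ← Subgroup.relIndex_mul_index hQN, hN, Nat.cast_mul]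
  choose s hs using hQ
  refine ⟨m.sum fun Q k => k * s Q, ?_⟩
  rw [← QuotientAddGroup.eq_zero_iff, QuotientAddGroup.mk_sub, QuotientAddGroup.mk_zsmul,
    h.coe_thetaRel, ← hy, hΘm]
  have h1 : (m.sum fun Q k => k • altClassOf C P l Q) =
      (m.sum fun Q k => k * (Q.index : ℤ)) • altClassOf C P l ⊤ +
        (m.sum fun Q k => k * s Q) • y := by
    simp only [Finsupp.sum]
    rw [sum_zsmul_right, sum_zsmul_right, ← Finset.sum_add_distrib]
    refine Finset.sum_congr rfl fun Q _ => ?_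
    rw [hs, zsmul_add, mul_zsmul, mul_zsmul]
  rw [h1, hm, zero_zsmul, zero_add, sub_self]

end IsFaithfulSemidirect

/-! ### A functional modulo p detecting primitive relations -/

open Classical in
/-- The indicator of the subgroups `H` of order `|P| / p` whose image in `P` does not contain
`K_i`. -/
def detect (p : ℕ) (C P : Subgroup G) {t : ℕ} (l : Fin t → ℕ) (i : Fin t) (H : Subgroup G) :
    ZMod p :=
  if Nat.card H * p = Nat.card P ∧ ¬ Kj C P l i ≤ (H ⊔ C).subgroupOf P then 1 else 0

namespace IsFaithfulSemidirect

variable [Finite G] {p : ℕ} {C P : Subgroup G} {t : ℕ} {l : Fin t → ℕ}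

theorem detect_conj (h : IsFaithfulSemidirect p C P l) (i : Fin t) (H : Subgroup G) (g : G) :
    detect p C P l i (H.map (MulAut.conj g).toMonoidHom) = detect p C P l i H := by
  have hcard : Nat.card (H.map (MulAut.conj g).toMonoidHom) = Nat.card H :=
    (Nat.card_congr (H.equivMapOfInjective _ (MulAut.conj g).injective).toEquiv).symm
  rw [detect, detect, h.sup_C_conj, hcard]

/-- A linear functional on the Burnside ring with values in `ℤ/p` that detects primitive
relations. -/
theorem exists_detectHom (h : IsFaithfulSemidirect p C P l)
    (i : Fin t) : ∃ φ : Burnside G →+ ZMod p,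
    ∀ n : Subgroup G →₀ ℤ, φ (toBurnside n) =
      n.sum fun H k => (k : ZMod p) * detect p C P l i H := by
  let f : SubgroupClass G → ZMod p := Quotient.lift (s := conjSetoid G) (detect p C P l i) (by
    rintro H _ ⟨g, rfl⟩
    exact (h.detect_conj i H g).symm)
  refine ⟨Finsupp.liftAddHom fun c => zmultiplesHom (ZMod p) (f c), fun n => ?_⟩
  induction n using Finsupp.induction_linear with
  | zero => simp
  | add a b ha hb =>
    rw [map_add, map_add, ha, hb, Finsupp.sum_add_index' (by simp) (by intros; push_cast; ring)]
  | single H k =>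
    rw [toBurnside_single, Finsupp.sum_single_index (by simp), map_zsmul]
    simp [cls, f]

theorem inf_C_of_card_mul (h : IsFaithfulSemidirect p C P l)
    {H : Subgroup G} (hH : Nat.card H * p = Nat.card P) : H ⊓ C = ⊥ :=
  h.inf_C_of_card_dvd (Dvd.intro _ hH)

theorem index_sup_C (h : IsFaithfulSemidirect p C P l)
    {H : Subgroup G} (hH : Nat.card H * p = Nat.card P) : (H ⊔ C).index = p := by
  have h1 := (H ⊔ C).card_mul_index
  rw [h.card_mul_card_C_eq (h.inf_C_of_card_mul hH), ← h.card_mul_card, ← hH] at h1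
  have h2 : Nat.card H * Nat.card C * (H ⊔ C).index = Nat.card H * Nat.card C * p := by
    rw [h1]; ring
  exact Nat.eq_of_mul_eq_mul_left (Nat.mul_pos Nat.card_pos Nat.card_pos) h2

theorem index_subgroupOf_P (h : IsFaithfulSemidirect p C P l)
    {H : Subgroup G} (hH : Nat.card H * p = Nat.card P) :
    ((H ⊔ C).subgroupOf P).index = p := by
  have hN := h.normal_sup_C H
  have h1 : P ⊔ (H ⊔ C) = ⊤ := by
    rw [eq_top_iff, ← h.compl.sup_eq_top]
    exact sup_le (le_sup_right.trans le_sup_right) le_sup_left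
  change (H ⊔ C).relIndex P = p
  rw [← Subgroup.relIndex_sup_right, h1, Subgroup.relIndex_top_right, h.index_sup_C hH]

open Classical in
/-- Among `p`-subgroups smaller than `P`, vanishing mass forces the coefficients of the
subgroups of order `|P| / p` to add up to zero modulo `p`. -/
theorem sum_card_eq_zero (h : IsFaithfulSemidirect p C P l) {m : Subgroup G →₀ ℤ}
    (hm : ∀ H ∈ m.support, H ⊓ C = ⊥ ∧ Nat.card H ≠ Nat.card P) (hm' : massAt 1 m = 0) :
    (m.sum fun H k => if Nat.card H * p = Nat.card P then (k : ZMod p) else 0) = 0 := by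
  have := Fact.mk h.prime
  obtain ⟨k, hk⟩ := h.isPGroup.exists_card_eq
  have hr : ∀ H ∈ m.support, ∃ r, r < k ∧ Nat.card H = p ^ r := by
    intro H hH
    have h1 := h.card_dvd_of_inf (hm H hH).1
    rw [hk, Nat.dvd_prime_pow h.prime] at h1
    obtain ⟨r, hr, hr'⟩ := h1
    refine ⟨r, lt_of_le_of_ne hr fun e => (hm H hH).2 ?_, hr'⟩
    rw [hr', hk, e]
  choose! r hrk hr using hr
  have hp0 : (p : ℚ) ≠ 0 := by exact_mod_cast h.prime.ne_zero
  -- All orders are at most p^(k-1) = |P|/p, so p^(k-1) clears denominators; modulo p only the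
  -- subgroups of exactly that order remain.
  have h1 : ((∑ H ∈ m.support, m H * (p : ℤ) ^ (k - 1 - r H) : ℤ) : ℚ) =
      massAt 1 m * p ^ (k - 1) := by
    rw [massAt_apply, Finsupp.sum, Finset.sum_mul, Int.cast_sum]
    refine Finset.sum_congr rfl fun H hH => ?_
    rw [if_pos H.one_mem, hr H hH]
    have e : (p : ℚ) ^ (k - 1) = p ^ (k - 1 - r H) * p ^ r H := by
      rw [← pow_add]; congr 1; have := hrk H hH; omega
    rw [e]
    push_cast
    field_simp
  rw [hm', zero_mul] at h1
  have h2 : (∑ H ∈ m.support, m H * (p : ℤ) ^ (k - 1 - r H) : ℤ) = 0 := by exact_mod_cast h1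
  have h3 := congrArg (Int.cast : ℤ → ZMod p) h2
  rw [Int.cast_sum, Int.cast_zero] at h3
  refine Eq.trans ?_ h3
  rw [Finsupp.sum]
  refine Finset.sum_congr rfl fun H hH => ?_
  have hlt := hrk H hH
  have hiff : Nat.card H * p = Nat.card P ↔ k - 1 - r H = 0 := by
    rw [hr H hH, hk, ← pow_succ, Nat.pow_right_inj h.prime.two_le]
    omega
  simp only [hiff]
  push_cast
  by_cases h0 : k - 1 - r H = 0
  · rw [if_pos h0, h0, pow_zero, mul_one]
  · rw [if_neg h0, ZMod.natCast_self, zero_pow h0, mul_zero]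

/-- |D| = |P|·|D ∩ C|, so D contains a subgroup of order |P|, which is conjugate to P. -/
theorem exists_conj_P_le (h : IsFaithfulSemidirect p C P l) {D : Subgroup G} (hD : D ⊔ C = ⊤) :
    ∃ g : G, ∀ x ∈ P, g * x * g⁻¹ ∈ D := by
  have := Fact.mk h.prime
  have hN := h.normal
  obtain ⟨k, hk⟩ := h.isPGroup.exists_card_eq
  have h1 := card_sup_mul_card_inf D C
  rw [hD, Subgroup.card_top, ← h.card_mul_card] at h1
  have h2 : Nat.card C * (Nat.card P * Nat.card (D ⊓ C : Subgroup G)) =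
      Nat.card C * Nat.card D := by rw [← mul_assoc, h1, mul_comm]
  have h3 := Nat.eq_of_mul_eq_mul_left Nat.card_pos h2
  obtain ⟨R, hR⟩ := Sylow.exists_subgroup_card_pow_prime (G := D) p (n := k)
    (by rw [← hk, ← h3]; exact Dvd.intro _ rfl)
  have hR' : Nat.card (R.map D.subtype) = p ^ k := by rw [card_map_subtype, hR]
  obtain ⟨g, hg⟩ := h.exists_conj_le (IsPGroup.of_card hR')
  have heq : (R.map D.subtype).map (MulAut.conj g).toMonoidHom = P := by
    refine Subgroup.eq_of_le_of_card_ge hg ?_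
    rw [hk, ← hR']
    exact (Nat.card_congr
      ((R.map D.subtype).equivMapOfInjective _ (MulAut.conj g).injective).toEquiv).le
  refine ⟨g⁻¹, fun x hx => ?_⟩
  rw [← heq] at hx
  obtain ⟨y, hy, rfl⟩ := hx
  refine Subgroup.map_subtype_le R ?_
  have e : g⁻¹ * (MulAut.conj g).toMonoidHom y * g⁻¹⁻¹ = y := by simp [mul_assoc]
  rw [e]
  exact hy

/-- For H ≤ D of order |P|/p the maximal subgroup HC must equal DC, so `detect` is constant on these
H, and `sum_card_eq_zero` applies to their coefficients. -/
theorem sum_detect_of_sup_ne_top (h : IsFaithfulSemidirect p C P l)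
    (i : Fin t) {D : Subgroup G} (hD : D ⊔ C ≠ ⊤)
    {n : Subgroup G →₀ ℤ} (hn : n ∈ relOn D) :
    (n.sum fun H k => (k : ZMod p) * detect p C P l i H) = 0 := by
  classical
  have hmass := h.massAt_filter_eq_zero hn (k := 1) D.one_mem (by simp) (r := 0) (by simp)
  have h1 := h.sum_card_eq_zero (m := n.filter fun H => H ⊓ C = ⊥) (fun H hH => ?_) hmass
  · rw [Finsupp.sum_filter_index, Finsupp.support_filter, Finset.sum_filter] at h1
    have h2 : ∀ H ∈ n.support, ((n H : ZMod p) * detect p C P l i H) =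
        (if H ⊓ C = ⊥ then if Nat.card H * p = Nat.card P then (n H : ZMod p) else 0 else 0) *
          if Kj C P l i ≤ (D ⊔ C).subgroupOf P then 0 else 1 := by
      intro H hH
      by_cases hc : Nat.card H * p = Nat.card P
      · have hsup : H ⊔ C = D ⊔ C := by
          have hle : H ⊔ C ≤ D ⊔ C := sup_le_sup_right (hn.1 H hH) C
          by_contra hne
          have hco := isCoatom_of_index_eq h.prime (h.index_sup_C hc)
          exact hD (hco.2 _ (lt_of_le_of_ne hle hne))
        rw [detect, hsup, if_pos (h.inf_C_of_card_mul hc), if_pos hc]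
        by_cases hK : Kj C P l i ≤ (D ⊔ C).subgroupOf P <;> simp [hK, hc]
      · simp [detect, hc]
    rw [Finsupp.sum, Finset.sum_congr rfl h2, ← Finset.sum_mul, h1, zero_mul]
  · rw [Finsupp.support_filter] at hH
    obtain ⟨hH, hHC⟩ := Finset.mem_filter.1 hH
    refine ⟨hHC, fun hcard => hD ?_⟩
    have h2 : H ⊔ C = ⊤ := by
      apply Subgroup.eq_top_of_card_eq
      rw [h.card_mul_card_C_eq hHC, hcard, mul_comm, h.card_mul_card]
    rw [eq_top_iff, ← h2]
    exact sup_le_sup_right (hn.1 H hH) C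

theorem sum_detect_of_sup_eq_top (h : IsFaithfulSemidirect p C P l)
    (hdich : ∀ M : Subgroup P, M.index = p → (∀ j, Kj C P l j ≤ M) ∨ ∀ j, ¬ Kj C P l j ≤ M)
    (i : Fin t) {D : Subgroup G} (hD : D ≠ ⊤) (hDC : D ⊔ C = ⊤)
    {n : Subgroup G →₀ ℤ} (hn : n ∈ relOn D) :
    (n.sum fun H k => (k : ZMod p) * detect p C P l i H) = 0 := by
  classical
  obtain ⟨g, hg⟩ := h.exists_conj_P_le hDC
  obtain ⟨j, hj⟩ : ∃ j, ¬ torsionPart C (l j) ≤ D := by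
    by_contra! hall
    apply hD
    have hle : C ≤ D := by
      rw [← h.cycPart_univ, cycPart_le_iff]
      exact fun j _ => hall j
    rwa [sup_eq_left.2 hle] at hDC
  have hDj := h.inf_le_cycPart_erase hj
  obtain ⟨k, hk⟩ := (Subgroup.isCyclic_iff_exists_zpowers_eq_top _).1 (h.isCyclic_Kj j)
  have hkK : k ∈ Kj C P l j := hk ▸ Subgroup.mem_zpowers k
  have hkcent := mem_Kj_iff.1 hkK
  obtain ⟨r, hr⟩ := h.exists_pow_eq_one k.2
  have hNj := h.normal_of_le (cycPart_le C l (Finset.univ.erase j))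
  have hNC := h.normal
  -- D misses some C_{l_j}, so D ∩ C lies in C_{≠j}, which K_j centralises. A generator of K_j,
  -- conjugated along with P into D, is therefore central in D.
  set k' : G := g * k * g⁻¹ with hk'
  have hk'D : k' ∈ D := hg k k.2
  have hk'r : k' ^ p ^ r = 1 := by rw [hk', conj_pow, hr, mul_one, mul_inv_cancel]
  have hcent : ∀ y ∈ D, y * k' = k' * y := by
    intro y hy
    obtain ⟨c, hc, x, hx, e⟩ := h.exists_mul_eq (g⁻¹ * y * g)
    have hgc : g * c * g⁻¹ ∈ D := by
      have h1 := D.mul_mem hy (D.inv_mem (hg x hx))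
      have e2 : c = g⁻¹ * y * g * x⁻¹ := by rw [← e]; group
      have e1 : y * (g * x * g⁻¹)⁻¹ = g * c * g⁻¹ := by
        rw [e2]; group
      rwa [e1] at h1
    have hcj : c ∈ cycPart C l (Finset.univ.erase j) := by
      have h1 := hNj.conj_mem _ (hDj ⟨hgc, hNC.conj_mem c hc g⟩) g⁻¹
      have e1 : g⁻¹ * (g * c * g⁻¹) * g⁻¹⁻¹ = c := by group
      rwa [e1] at h1
    have hyk : (g⁻¹ * y * g) * k = k * (g⁻¹ * y * g) := by
      rw [← e, mul_assoc, h.commute_of_mem_P hx k.2, ← mul_assoc, hkcent c hcj, mul_assoc]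
    calc y * k' = g * ((g⁻¹ * y * g) * k) * g⁻¹ := by rw [hk']; group
      _ = k' * y := by rw [hyk, hk']; group
  -- If k' = xc with x ∈ H and c ∈ C, then c ∈ D commutes with k', so c⁻¹k' ∈ H; coprimality of
  -- orders gives k' ∈ H.
  have hmem : ∀ H : Subgroup G, H ≤ D → (k' ∈ H ↔ Kj C P l j ≤ (H ⊔ C).subgroupOf P) := by
    intro H hHD
    have hNH := h.normal_sup_C H
    have hk1 : Kj C P l j ≤ (H ⊔ C).subgroupOf P ↔ k' ∈ H ⊔ C := by
      rw [← hk, Subgroup.zpowers_le, Subgroup.mem_subgroupOf]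
      exact (hNH.mem_comm_iff.trans (by rw [inv_mul_cancel_left])).symm
    rw [hk1]
    refine ⟨fun h1 => Subgroup.mem_sup_left h1, fun h1 => ?_⟩
    obtain ⟨x, hx, c, hc, e⟩ := Subgroup.mem_sup_of_normal_right.1 h1
    have hxk := hcent x (hHD hx)
    have hcD : c ∈ D := by
      have e1 : c = x⁻¹ * k' := by rw [← e]; group
      rw [e1]
      exact D.mul_mem (D.inv_mem (hHD hx)) hk'D
    have hck : Commute c k' := hcent c hcD
    have e2 : c⁻¹ * k' ∈ H := by
      rw [hck.inv_left.eq, ← e, mul_inv_cancel_right]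
      exact hx
    exact (h.mem_of_mul_mem (C.inv_mem hc) hck.inv_left hk'r e2).2
  have hmass1 := h.massAt_filter_eq_zero hn (k := 1) D.one_mem (by simp) (r := 0) (by simp)
  have hmassk := h.massAt_filter_eq_zero hn hk'D hcent hk'r
  set m := n.filter fun H => H ⊓ C = ⊥ with hm
  -- Subtracting the mass at k' from the mass at 1 isolates the subgroups omitting k'; none of these
  -- has order |P|.
  have hmass : massAt 1 (m.filter fun H => k' ∉ H) = 0 := by
    have h1 : massAt 1 (m.filter fun H => k' ∉ H) = massAt 1 m - massAt k' m := by
      simp only [massAt_apply]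
      rw [Finsupp.sum_filter_index, Finsupp.support_filter, Finset.sum_filter, Finsupp.sum,
        Finsupp.sum, ← Finset.sum_sub_distrib]
      refine Finset.sum_congr rfl fun H _ => ?_
      by_cases hkH : k' ∈ H <;> simp [hkH, H.one_mem]
    rw [h1, hmass1, hmassk, sub_self]
  have h1 := h.sum_card_eq_zero (m := m.filter fun H => k' ∉ H) (fun H hH => ?_) hmass
  · rw [Finsupp.sum_filter_index, Finsupp.support_filter, hm, Finsupp.support_filter,
      Finset.filter_filter, Finset.sum_filter] at h1
    rw [← h1, Finsupp.sum]
    refine Finset.sum_congr rfl fun H hH => ?_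
    by_cases hc : Nat.card H * p = Nat.card P
    · have hHC := h.inf_C_of_card_mul hc
      have hij : Kj C P l i ≤ (H ⊔ C).subgroupOf P ↔ Kj C P l j ≤ (H ⊔ C).subgroupOf P := by
        rcases hdich _ (h.index_subgroupOf_P hc) with h2 | h2
        · exact iff_of_true (h2 i) (h2 j)
        · exact iff_of_false (h2 i) (h2 j)
      rw [detect, hij, ← hmem H (hn.1 H hH)]
      by_cases hkH : k' ∈ H <;> simp [hkH, hc, hHC]
    · simp [detect, hc]
  · rw [Finsupp.support_filter, hm, Finsupp.support_filter, Finset.filter_filter] at hH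
    obtain ⟨hH, hHC, hkH⟩ := Finset.mem_filter.1 hH
    refine ⟨hHC, fun hcard => hkH ?_⟩
    rw [hmem H (hn.1 H hH)]
    have h2 : H ⊔ C = ⊤ := by
      apply Subgroup.eq_top_of_card_eq
      rw [h.card_mul_card_C_eq hHC, hcard, mul_comm, h.card_mul_card]
    rw [h2]
    exact fun x _ => Subgroup.mem_subgroupOf.2 (Subgroup.mem_top _)

/-- A normal N inside a subgroup avoiding C commutes with C, hence lies in C and is trivial. So no
subgroup above N ≠ 1 is counted. -/
theorem sum_detect_of_relAbove (h : IsFaithfulSemidirect p C P l)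
    (i : Fin t) {N : Subgroup G} (hN : N.Normal) (hN' : N ≠ ⊥)
    {n : Subgroup G →₀ ℤ} (hn : n ∈ relAbove N) :
    (n.sum fun H k => (k : ZMod p) * detect p C P l i H) = 0 := by
  refine Finset.sum_eq_zero fun H hH => ?_
  have hc : ¬ Nat.card H * p = Nat.card P := by
    intro hc
    apply hN'
    have hHC := h.inf_C_of_card_mul hc
    have hNC : N ⊓ C = ⊥ := eq_bot_iff.2 (hHC ▸ inf_le_inf_right C (hn.1 H hH))
    have hle : N ≤ C := by
      intro x hx
      refine h.mem_C_of_centralizes fun c hc => ?_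
      have hC := h.normal
      exact Subgroup.commute_of_normal_of_disjoint C N hC hN
        (disjoint_iff.2 (by rw [inf_comm, hNC])) c x hc hx
    rwa [inf_eq_left.2 hle] at hNC
  simp [detect, hc]

theorem thetaRel_notMem_imprimitive (h : IsFaithfulSemidirect p C P l) (ht : 1 < t)
    (hdich : ∀ M : Subgroup P, M.index = p → (∀ j, Kj C P l j ≤ M) ∨ ∀ j, ¬ Kj C P l j ≤ M)
    {M M' : Subgroup P} (hM' : M'.index = p) (hall : ∀ j, Kj C P l j ≤ M)
    (hnone : ∀ j, ¬ Kj C P l j ≤ M') : thetaRel C P M M' ∉ imprimitive G := by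
  classical
  have := Fact.mk h.prime
  have i : Fin t := ⟨0, by omega⟩
  obtain ⟨φ, hφ⟩ := h.exists_detectHom i
  have hle : imprimitive G ≤ φ.ker := by
    refine imprimitive_le (fun D hD n hn => ?_) fun N hN hN' n hn => ?_
    · rw [AddMonoidHom.mem_ker, hφ]
      by_cases hDC : D ⊔ C = ⊤
      · exact h.sum_detect_of_sup_eq_top hdich i hD hDC hn
      · exact h.sum_detect_of_sup_ne_top i hDC hn
    · rw [AddMonoidHom.mem_ker, hφ]
      exact h.sum_detect_of_relAbove i hN hN' hn
  intro hmem
  have h0 : φ (thetaRel C P M M') = 0 := hle hmem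
  have hsub : ∀ Q : Subgroup P, (Q.map P.subtype ⊔ C).subgroupOf P = Q := by
    intro Q
    ext x
    rw [Subgroup.mem_subgroupOf]
    have h1 := h.mul_mem_sup_iff (Subgroup.map_subtype_le Q) le_rfl x.2 C.one_mem
    rw [mul_one] at h1
    rw [h1, coe_mem_map_subtype]
    exact and_iff_left C.one_mem
  -- For A ≠ ∅ the subgroup Q·C_A meets C, so it cannot have order |P|/p; only the term A = ∅ is
  -- seen.
  have hval : ∀ Q : Subgroup P,
      φ (toBurnside (altHom C l Finset.univ (Finsupp.single (Q.map P.subtype) 1))) =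
        detect p C P l i (Q.map P.subtype) := by
    intro Q
    rw [altHom_single, map_sum, map_sum,
      Finset.sum_eq_single_of_mem ∅ (Finset.empty_mem_powerset _)]
    · rw [map_zsmul, map_zsmul, hφ, Finsupp.sum_single_index (by simp), cycPart_empty, sup_bot_eq]
      simp
    · intro A _ hA
      rw [map_zsmul, map_zsmul, hφ, Finsupp.sum_single_index (by simp), detect, if_neg, mul_zero,
        smul_zero]
      rintro ⟨hc, -⟩
      have h1 := h.inf_C_of_card_mul hc
      apply hA
      apply h.cycPart_injective
      rw [cycPart_empty, eq_bot_iff, ← h1]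
      exact le_inf le_sup_right (cycPart_le C l A)
  have hcard : Nat.card (M'.map P.subtype) * p = Nat.card P := by
    rw [card_map_subtype, ← hM', M'.card_mul_index]
  rw [h.thetaRel_eq, map_sub, map_sub, map_sub, hval, hval, detect, detect, hsub, hsub,
    if_neg fun h1 => h1.2 (hall i), if_pos ⟨hcard, hnone i⟩] at h0
  simp at h0

end IsFaithfulSemidirect

end BrauerRel

end

/-! ### The main theorem -/

theorem theorem7p8 {G : Type*} [Group G] [Finite G]
    (p : ℕ) (hp : p.Prime) (C P : Subgroup G)
    -- `G = C ⋊ P` with `C` cyclic and `P` a `p`-group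
    (hCnormal : C.Normal) (hCcyclic : IsCyclic C) (hP : IsPGroup p P)
    (hCP : Subgroup.IsComplement' C P)
    -- `|C| = l₁ ⋯ l_t` with distinct primes `l_j ≠ p` and `t > 1`
    (t : ℕ) (ht : 1 < t) (l : Fin t → ℕ) (hl : ∀ j, (l j).Prime) (hlp : ∀ j, l j ≠ p)
    (hlinj : Function.Injective l) (hCcard : Nat.card C = ∏ j, l j)
    -- `P` acts faithfully on `C`
    (hfaithful : BrauerRel.actionKer P C = ⊥) :
    -- `G` has a primitive relation iff all `K_j` have the same non-trivial image in `P/Φ(P)`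
    (BrauerRel.HasPrimitiveRelation G ↔
      (∀ i j, BrauerRel.frattiniImage (BrauerRel.Kj C P l i) =
        BrauerRel.frattiniImage (BrauerRel.Kj C P l j)) ∧
      ∀ j, BrauerRel.frattiniImage (BrauerRel.Kj C P l j) ≠ ⊥) ∧
    -- equivalently, iff the set of signatures of the index `p` subgroups of `P` is
    -- `{(1,…,1), (0,…,0)}`
    (BrauerRel.HasPrimitiveRelation G ↔
      BrauerRel.signature C P l '' {M : Subgroup P | M.index = p} =
        {fun _ => 1, fun _ => 0}) ∧
    -- in that case `Prim(G)` is cyclic of order `p`, generated by the class of the relation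
    (BrauerRel.HasPrimitiveRelation G →
      Nonempty (BrauerRel.Prim G ≃+ ZMod p) ∧
      ∀ M M' : Subgroup P, M.index = p → M'.index = p →
        BrauerRel.signature C P l M = (fun _ => 1) →
        BrauerRel.signature C P l M' = (fun _ => 0) →
        ∃ h : BrauerRel.thetaRel C P M M' ∈ BrauerRel.relations G,
          AddSubgroup.zmultiples
            (QuotientAddGroup.mk ⟨BrauerRel.thetaRel C P M M', h⟩ : BrauerRel.Prim G) = ⊤) := by
  have h : BrauerRel.IsFaithfulSemidirect p C P l :=
    ⟨hp, hCnormal, hCcyclic, hP, hCP, hl, hlp, hlinj, hCcard, hfaithful⟩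
  have hiff : BrauerRel.HasPrimitiveRelation G ↔ BrauerRel.SignatureDichotomy p C P l := by
    constructor
    · rintro ⟨Θ, hΘ, hΘ'⟩
      by_contra hc
      exact hΘ' (h.relations_le_imprimitive ht hc hΘ)
    · rintro ⟨hdich, ⟨M, hM, hall⟩, ⟨M', hM', hnone⟩⟩
      exact ⟨_, h.thetaRel_mem_relations hM hM',
        h.thetaRel_notMem_imprimitive ht hdich hM' hall hnone⟩
  rw [h.frattiniImage_iff_signatureDichotomy ht, BrauerRel.image_signature_eq_iff]
  refine ⟨hiff, hiff, fun hprim => ?_⟩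
  obtain ⟨hdich, ⟨M₁, hM₁, hall₁⟩, ⟨M₀, hM₀, hnone₀⟩⟩ := hiff.1 hprim
  have hgen : ∀ M M' : Subgroup P, M.index = p → M'.index = p →
      (∀ j, BrauerRel.Kj C P l j ≤ M) → (∀ j, ¬ BrauerRel.Kj C P l j ≤ M') →
      ∃ h : BrauerRel.thetaRel C P M M' ∈ BrauerRel.relations G,
        AddSubgroup.zmultiples
          (QuotientAddGroup.mk ⟨BrauerRel.thetaRel C P M M', h⟩ : BrauerRel.Prim G) = ⊤ := by
    intro M M' hM hM' hall hnone
    refine ⟨h.thetaRel_mem_relations hM hM', ?_⟩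
    rw [eq_top_iff]
    rintro x -
    obtain ⟨⟨Θ, hΘ⟩, rfl⟩ := QuotientAddGroup.mk_surjective x
    obtain ⟨k, hk⟩ := h.exists_sub_zsmul_thetaRel_mem ht hdich hM hM' hall hnone hΘ
    refine ⟨k, ?_⟩
    symm
    exact QuotientAddGroup.eq_iff_sub_mem.2 (AddSubgroup.mem_addSubgroupOf.2 hk)
  refine ⟨?_, fun M M' hM hM' hs hs' => hgen M M' hM hM'
    (BrauerRel.signature_eq_one_iff.1 hs) (BrauerRel.signature_eq_zero_iff.1 hs')⟩
  obtain ⟨hrel, htop⟩ := hgen M₁ M₀ hM₁ hM₀ hall₁ hnone₀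
  have := Fact.mk hp
  have hord : addOrderOf (QuotientAddGroup.mk ⟨BrauerRel.thetaRel C P M₁ M₀, hrel⟩ :
      BrauerRel.Prim G) = p := by
    refine addOrderOf_eq_prime ?_ ?_
    · rw [← natCast_zsmul, ← QuotientAddGroup.mk_zsmul, QuotientAddGroup.eq_zero_iff]
      exact AddSubgroup.mem_addSubgroupOf.2 (h.prime_smul_thetaRel_mem hM₁ hM₀)
    · intro h0
      exact h.thetaRel_notMem_imprimitive ht hdich hM₀ hall₁ hnone₀
        (AddSubgroup.mem_addSubgroupOf.1 ((QuotientAddGroup.eq_zero_iff _).1 h0))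
  have hcard : Nat.card (BrauerRel.Prim G) = p := by
    rw [← hord, ← Nat.card_zmultiples, htop]
    exact (Nat.card_congr AddSubgroup.topEquiv.toEquiv).symm
  exact ⟨addEquivOfPrimeCardEq hcard (Nat.card_zmod p)⟩
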